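/- **Setting.** Let $\nu$ be a finite nonzero (carrier) measure on a measurable space $\mathcal X$, let $\phi:\mathcal X\to\mathbb R^d$ be measurable with $|\phi_j(x)|\le C$ for all $x$ and $j$, and let $p_\theta(dx)=e^{\theta\cdot\phi(x)-\Lambda(\theta)}\,\nu(dx)$ with $\Lambda(\theta)=\log\int e^{\theta\cdot\phi}\,d\nu$. Let $\Theta\subset\mathbb R^d$ be compact and convex with $\theta^*$ in its interior, and suppose that for every $\theta\in\Theta$ no nontrivial linear combination of $\phi_1(X),\dots,\phi_d(X)$ is $p_\theta$-almost surely constant. Let $\lambda=\inf_{\theta\in\Theta}\lambda(\theta)$, where $\lambda(\theta)$ is the smallest eigenvalue of $\mathrm{Cov}_\theta[\phi(X)]=\nabla^2\Lambda(\theta)$, and let $L$ be a Lipschitz constant on $\Theta$ of $\theta\mapsto\sqrt{e^{-2\Lambda(\theta^*)+\Lambda(\theta)+\Lambda(2\theta^*-\theta)}-1}$. For $\theta\in\Theta$ let $k_\theta$ be a Markov kernel on $\mathcal X$ with invariant distribution $p_\theta$, let $\alpha(\theta)$ be the norm of the operator $f\mapsto\int f(y)\,k_\theta(\cdot,dy)$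 on the space of mean-zero functions in $L^2(p_\theta)$ (so $1-\alpha(\theta)$ is the $L^2$-spectral gap), and assume $\alpha=\sup_{\theta\in\Theta}\alpha(\theta)<1$. Fix $m$ with $\lambda-\sqrt d\,C L\alpha^m>0$. Given a data sample $\mathbf x=(x_1,\dots,x_n)\in\mathcal X^n$, $n\ge1$, let $\hat\theta_n\in\Theta$ be a maximizer over $\Theta$ of the likelihood $\prod_i e^{\theta\cdot\phi(x_i)-\Lambda(\theta)}$. Given learning rates $\eta_t\ge0$, CD-$m$ started at a (possibly random) $\theta_0\in\Theta$ generates $$\theta_{t+1}=\theta_t+\eta_t\Big(\tfrac1n\sum_{i=1}^n\phi(x_i)-\tfrac1n\sum_{i=1}^n\phi(X_i^{(m)})\Big)\mathbb I(\theta_t\notin\partial\Theta_t),\qquad \partial\Theta_t=\Big\{\theta\in\Theta:\inf_{\theta'\in\partial\Theta}\|\theta-\theta'\|\le2\eta_t\sqrt d\,C\Big\},$$ where at each step $t$, conditionally on the past up to and including $\theta_t$, the $X_i^{(m)}$ are freshly drawn, independent over $i$, with $X_i^{(m)}\sim k_{\theta_t}^m(x_i,\cdot)$. Let $\mathbb P^{\mathbf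 x}$ be the law of this algorithm for the fixed sample $\mathbf x$, and $\bar\theta_t=\sum_{s=0}^t\eta_s\theta_s\big/\sum_{s=0}^t\eta_s$. **Claim.** There is a constant $K$, which may depend on $m$ and on the model ($\nu,\phi,C,\Theta,\theta^*,L$ and the kernels $k_\theta$) but not on $n$, the data sample $\mathbf x$, $\gamma$ or $(\eta_t)$, such that the following holds. Let $\gamma\in(0,1/2)$, let $\eta_t\ge0$ satisfy $\sum_{s=0}^t\eta_s/\sqrt{\log t}\to\infty$ and $\sum_t\eta_t^2<\infty$, let $n\ge1$, and let $\mathbf x$ (with $\hat\theta_n$) satisfy $$\sqrt n\,\|\hat\theta_n-\theta^*\|<n^\gamma,\qquad \sup_{\theta\in\Theta}\sqrt n\,\Big\|\frac1n\sum_{i=1}^n\int\phi(y)\,k_\theta^m(x_i,dy)-\int\phi(y)\,(k_\theta^m p_{\theta^*})(dy)\Big\|<n^\gamma .$$ Then, $\mathbb P^{\mathbf x}$-almost surely on the event that $\theta_t\in\partial\Theta_t$ for only finitely many $t$, $$\limsup_{t\to\infty}\|\bar\theta_t-\hat\theta_n\|\le K\,n^{-(1-2\gamma)/3}.$$ -/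

import Mathlib

open MeasureTheory ProbabilityTheory Filter Topology
open scoped ENNReal NNReal

namespace CD

noncomputable section

/-- The parameter space `ℝ^d` with its Euclidean norm. -/
abbrev E (d : ℕ) : Type := EuclideanSpace ℝ (Fin d)

/-! ### The exponential family

`ν` is the carrier measure `c(x) dx` and `φ` the sufficient statistic. -/

section Family

variable {𝒳 : Type*} [MeasurableSpace 𝒳] {d : ℕ}

/-- The log-partition function `Λ(θ) = log ∫ exp (θ · φ(x)) ν(dx)`. -/
def logPartition (ν : Measure 𝒳) (φ : 𝒳 → E d) (θ : E d) : ℝ :=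
  Real.log (∫ x, Real.exp (inner ℝ θ (φ x)) ∂ν)

/-- The density `exp (θ · φ(x) - Λ(θ))` of `p_θ` with respect to the carrier measure. -/
def density (ν : Measure 𝒳) (φ : 𝒳 → E d) (θ : E d) (x : 𝒳) : ℝ :=
  Real.exp (inner ℝ θ (φ x) - logPartition ν φ θ)

/-- The distribution `p_θ`. -/
def law (ν : Measure 𝒳) (φ : 𝒳 → E d) (θ : E d) : Measure 𝒳 :=
  ν.withDensity fun x => ENNReal.ofReal (density ν φ θ x)

/-- The components of `φ(X)` are linearly independent under `p_θ`: no nontrivial linear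
combination of them is almost surely constant. -/
def LinIndepUnder (ν : Measure 𝒳) (φ : 𝒳 → E d) (θ : E d) : Prop :=
  ∀ u : E d, u ≠ 0 → ∀ b : ℝ, ¬ ∀ᵐ x ∂(law ν φ θ), inner ℝ u (φ x) = b

/-- The covariance matrix `Cov_θ[φ(X)] = ∇²Λ(θ)`. -/
def covMatrix (ν : Measure 𝒳) (φ : 𝒳 → E d) (θ : E d) : Matrix (Fin d) (Fin d) ℝ :=
  Matrix.of fun i j => covariance (fun x => φ x i) (fun x => φ x j) (law ν φ θ)

/-- The smallest eigenvalue `λ(θ)` of `Cov_θ[φ(X)]`. -/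
def minEigenvalue (ν : Measure 𝒳) (φ : 𝒳 → E d) (θ : E d) : ℝ :=
  sInf {μ : ℝ | Module.End.HasEigenvalue (Matrix.toLin' (covMatrix ν φ θ)) μ}

/-- `λ = inf_{θ ∈ Θ} λ(θ)`. -/
def lam (ν : Measure 𝒳) (φ : 𝒳 → E d) (Θ : Set (E d)) : ℝ :=
  ⨅ θ : Θ, minEigenvalue ν φ θ

/-- The function `θ ↦ √(exp (-2 Λ(θ*) + Λ(θ) + Λ(2θ* - θ)) - 1)`. -/
def chi (ν : Measure 𝒳) (φ : 𝒳 → E d) (θstar θ : E d) : ℝ :=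
  Real.sqrt (Real.exp (-2 * logPartition ν φ θstar + logPartition ν φ θ
    + logPartition ν φ ((2 : ℝ) • θstar - θ)) - 1)

/-- `θhat` is a maximum likelihood estimate over `Θ` for the data sample `x`. -/
def IsMLE (ν : Measure 𝒳) (φ : 𝒳 → E d) (Θ : Set (E d)) {n : ℕ} (x : Fin n → 𝒳)
    (θhat : E d) : Prop :=
  θhat ∈ Θ ∧ IsMaxOn (fun θ => ∏ i, density ν φ θ (x i)) Θ θhat

end Family

/-! ### Markov kernels

The power `κ ^ m` of a kernel is its `m`-step transition kernel. -/

section Kernels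

variable {𝒳 : Type*} [MeasurableSpace 𝒳] {d : ℕ}

/-- The operator norm on `L²₀(π)`, the mean-zero functions in `L²(π)`, of the Markov operator
`f ↦ (x ↦ ∫ f(y) κ(x, dy))`; the `L²`-spectral gap of `κ` is one minus this number. -/
def l2Norm (κ : Kernel 𝒳 𝒳) (π : Measure 𝒳) : ℝ≥0∞ :=
  ⨆ (f : 𝒳 → ℝ) (_ : MemLp f 2 π) (_ : ∫ x, f x ∂π = 0) (_ : eLpNorm f 2 π ≤ 1),
    eLpNorm (fun x => ∫ y, f y ∂(κ x)) 2 π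

/-- `α = sup_{θ ∈ Θ} α(θ)`, where `1 - α(θ)` is the `L²`-spectral gap of `k_θ`. -/
def alpha (ν : Measure 𝒳) (φ : 𝒳 → E d) (Θ : Set (E d)) (k : E d → Kernel 𝒳 𝒳) : ℝ≥0∞ :=
  ⨆ θ ∈ Θ, l2Norm (k θ) (law ν φ θ)

/-- `a_m = λ - √d C L α^m`. -/
def aCoef (ν : Measure 𝒳) (φ : 𝒳 → E d) (Θ : Set (E d)) (k : E d → Kernel 𝒳 𝒳)
    (C : ℝ) (L : ℝ≥0) (m : ℕ) : ℝ :=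
  lam ν φ Θ - Real.sqrt d * C * L * (alpha ν φ Θ k).toReal ^ m

/-- The uniform deviation
`sup_{θ ∈ Θ} √n ‖(1/n) ∑ᵢ ∫ φ(y) k_θ^m(xᵢ, dy) - ∫ φ(y) (k_θ^m p_{θ*})(dy)‖`. -/
def empiricalDeviation (ν : Measure 𝒳) (φ : 𝒳 → E d) (Θ : Set (E d)) (θstar : E d)
    (k : E d → Kernel 𝒳 𝒳) (m : ℕ) {n : ℕ} (x : Fin n → 𝒳) : ℝ :=
  ⨆ θ : Θ, Real.sqrt n *
    ‖(1 / n : ℝ) • ∑ i, (∫ y, φ y ∂((k θ ^ m) (x i)))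
      - ∫ y, φ y ∂((law ν φ θstar).bind (k θ ^ m))‖

end Kernels

/-! ### The CD-`m` algorithm -/

section Algorithm

variable {𝒳 : Type*} [MeasurableSpace 𝒳] {d : ℕ}

/-- The boundary layer
`∂Θ_t = {θ ∈ Θ : inf_{θ' ∈ ∂Θ} ‖θ - θ'‖ ≤ 2 η_t √d C}`, as a function of `η_t`. -/
def boundaryLayer (Θ : Set (E d)) (C ηt : ℝ) : Set (E d) :=
  {θ ∈ Θ | Metric.infDist θ (frontier Θ) ≤ 2 * ηt * Real.sqrt d * C}

/-- The CD gradient `(1/n) ∑ᵢ φ(xᵢ) - (1/n) ∑ᵢ φ(yᵢ)`, where `yᵢ` is the end point of the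
MCMC run started at the datum `xᵢ`. -/
def cdGradient (φ : 𝒳 → E d) {n : ℕ} (x y : Fin n → 𝒳) : E d :=
  (1 / n : ℝ) • ∑ i, φ (x i) - (1 / n : ℝ) • ∑ i, φ (y i)

/-- `θ` is the sequence of parameters generated by CD-`m` from the fixed data sample `x`, with
learning rates `η`, on a probability space with measure `P` (the law `ℙ^x`). `Y t i` is the end
point `X_i^{(m)}` of the MCMC run that is started at `x i` in iteration `t`: given the history
`ℱ t`, the `Y t i` are independent with laws `k_{θ_t}^m(x i, ·)`. -/
structure IsCDRun {Ω : Type*} [mΩ : MeasurableSpace Ω] (P : Measure Ω) (ℱ : Filtration ℕ mΩ)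
    (φ : 𝒳 → E d) (C : ℝ) (Θ : Set (E d)) (k : E d → Kernel 𝒳 𝒳) (m : ℕ) (η : ℕ → ℝ)
    {n : ℕ} (x : Fin n → 𝒳) (θ : ℕ → Ω → E d) (Y : ℕ → Fin n → Ω → 𝒳) : Prop where
  adapted : ∀ t, Measurable[ℱ t] (θ t)
  measurable_sample : ∀ t i, Measurable (Y t i)
  init : ∀ ω, θ 0 ω ∈ Θ
  cond_law : ∀ t, ∀ A : Fin n → Set 𝒳, (∀ i, MeasurableSet (A i)) →
    P[(⋂ i, Y t i ⁻¹' A i).indicator (fun _ => (1 : ℝ)) | ℱ t]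
      =ᵐ[P] fun ω => ∏ i, ((k (θ t ω) ^ m) (x i)).real (A i)
  step_inside : ∀ t ω, θ t ω ∉ boundaryLayer Θ C (η t) →
    θ (t + 1) ω = θ t ω + η t • cdGradient φ x (fun i => Y t i ω)
  step_boundary : ∀ t ω, θ t ω ∈ boundaryLayer Θ C (η t) → θ (t + 1) ω = θ t ω

/-- The weighted average `∑_{s=0}^t η_s θ_s / ∑_{s=0}^t η_s`. -/
def wavg (η : ℕ → ℝ) (θ : ℕ → E d) (t : ℕ) : E d :=
  (∑ s ∈ Finset.range (t + 1), η s)⁻¹ • ∑ s ∈ Finset.range (t + 1), η s • θ s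

end Algorithm

end

end CD

namespace CD

set_option linter.unusedSectionVars false

/-! The squared error `‖θ_t - θhat‖²` serves as a Lyapunov function. Write `u = θ - θhat` and `ε =
n^γ / √n`. If `θhat` is interior, the likelihood equation (`IsMLE.moment_eq`) turns the data average
of `φ` into its mean under `p_θhat`. The conditional mean of the CD gradient is then the mean of `φ`
under `p_θhat` minus that under `p_θ`, up to two errors: the empirical deviation, at most `ε`, and
the bias of starting `m` steps from `p_θstar` instead of `p_θ`. Strong monotonicity
(`lam_mul_le_integral_sub`) makes the main term pull towards `θhat`. A change of measure,
Cauchy–Schwarz and the spectral gap bound the bias by `√d C α^m` times the χ-distance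
(`abs_integral_law_sub_le`), hence by a multiple of `‖θ - θstar‖ ≤ ‖u‖ + ε`. Together
(`inner_cdDrift_le`) the drift along `u` is at most `-a ‖u‖² + b ε ‖u‖`, where `a > 0` is `aCoef`.

Telescoping the squared error, with square-summable steps and convergent martingale noise
(`ae_exists_tendsto_sum_sub_condExp`), bounds `∑ η_s (a ‖u_s‖² - b ε ‖u_s‖)` along almost every
path, boundary times omitted. Completing the square and dividing by `∑ η_s → ∞` gives limsup at most
`b ε / a` (`limsup_enorm_wavg_le_of_quadratic`). If `ε` is too large to force `θhat` into the
interior, the diameter of `Θ` is already a bound of order `ε`. -/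

lemma norm_le_sqrt_mul {d : ℕ} {C : ℝ} (v : E d) (hv : ∀ j, |v j| ≤ C) :
    ‖v‖ ≤ Real.sqrt d * C := by
  rcases Nat.eq_zero_or_pos d with rfl | hd
  · have : v = 0 := by ext j; exact j.elim0
    simp [this]
  · have hC : 0 ≤ C := (abs_nonneg _).trans (hv ⟨0, hd⟩)
    rw [EuclideanSpace.norm_eq]
    apply Real.sqrt_le_iff.2 ⟨by positivity, ?_⟩
    rw [mul_pow, Real.sq_sqrt (Nat.cast_nonneg d)]
    calc ∑ i, ‖v i‖ ^ 2 ≤ ∑ _i : Fin d, C ^ 2 :=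
          Finset.sum_le_sum fun i _ => pow_le_pow_left₀ (norm_nonneg _) (hv i) 2
      _ = d * C ^ 2 := by simp

/-! ### Exponential family: tilting, strong monotonicity of the mean map, likelihood equation,
χ²-divergence. -/

section Family

variable {𝒳 : Type*} [MeasurableSpace 𝒳] {d : ℕ} {ν : Measure 𝒳} {φ : 𝒳 → E d} {C : ℝ}

lemma abs_inner_le (hC : ∀ x j, |φ x j| ≤ C) (u : E d) (x : 𝒳) :
    |inner ℝ u (φ x)| ≤ ‖u‖ * (Real.sqrt d * C) :=
  (abs_real_inner_le_norm u (φ x)).trans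
    (mul_le_mul_of_nonneg_left (norm_le_sqrt_mul _ (hC x)) (norm_nonneg u))

lemma measurable_inner_stat (hφ : Measurable φ) (u : E d) :
    Measurable fun x => inner ℝ u (φ x) := by fun_prop

lemma integrable_of_abs_le {μ : Measure 𝒳} [IsFiniteMeasure μ] {f : 𝒳 → ℝ} {B : ℝ}
    (hf : Measurable f) (hB : ∀ x, |f x| ≤ B) : Integrable f μ :=
  Integrable.of_bound hf.aestronglyMeasurable B (Eventually.of_forall hB)

lemma integrable_exp_inner [IsFiniteMeasure ν] (hφ : Measurable φ) (hC : ∀ x j, |φ x j| ≤ C)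
    (u : E d) : Integrable (fun x => Real.exp (inner ℝ u (φ x))) ν := by
  refine integrable_of_abs_le (B := Real.exp (‖u‖ * (Real.sqrt d * C))) (by fun_prop) fun x => ?_
  rw [abs_of_pos (Real.exp_pos _)]
  exact Real.exp_le_exp.2 ((le_abs_self _).trans (abs_inner_le hC u x))

lemma integral_exp_inner_pos [IsFiniteMeasure ν] (hν : ν ≠ 0) (hφ : Measurable φ)
    (hC : ∀ x j, |φ x j| ≤ C) (u : E d) : 0 < ∫ x, Real.exp (inner ℝ u (φ x)) ∂ν := by
  have : NeZero ν := ⟨hν⟩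
  exact integral_exp_pos (integrable_exp_inner hφ hC u)

lemma exp_logPartition [IsFiniteMeasure ν] (hν : ν ≠ 0) (hφ : Measurable φ)
    (hC : ∀ x j, |φ x j| ≤ C) (u : E d) :
    Real.exp (logPartition ν φ u) = ∫ x, Real.exp (inner ℝ u (φ x)) ∂ν :=
  Real.exp_log (integral_exp_inner_pos hν hφ hC u)

lemma law_eq_tilted [IsFiniteMeasure ν] (hν : ν ≠ 0) (hφ : Measurable φ)
    (hC : ∀ x j, |φ x j| ≤ C) (θ : E d) :
    law ν φ θ = ν.tilted fun x => inner ℝ θ (φ x) := by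
  simp only [law, density, Measure.tilted, Real.exp_sub, exp_logPartition hν hφ hC θ]

lemma isProbabilityMeasure_law [IsFiniteMeasure ν] (hν : ν ≠ 0) (hφ : Measurable φ)
    (hC : ∀ x j, |φ x j| ≤ C) (θ : E d) : IsProbabilityMeasure (law ν φ θ) := by
  have : NeZero ν := ⟨hν⟩
  rw [law_eq_tilted hν hφ hC]
  exact isProbabilityMeasure_tilted (integrable_exp_inner hφ hC θ)

/-- Expectations under `p_θ` as integrals against the carrier measure. -/
lemma integral_law [IsFiniteMeasure ν] (hν : ν ≠ 0) (hφ : Measurable φ)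
    (hC : ∀ x j, |φ x j| ≤ C) (θ : E d) (g : 𝒳 → ℝ) :
    ∫ x, g x ∂(law ν φ θ) = ∫ x, density ν φ θ x * g x ∂ν := by
  rw [law_eq_tilted hν hφ hC, integral_tilted]
  simp only [density, Real.exp_sub, exp_logPartition hν hφ hC θ, smul_eq_mul]

/-- Moving the parameter along a line is exponential tilting by a scalar variable, so the
one-dimensional calculus of cumulant generating functions applies. -/
lemma law_add [IsFiniteMeasure ν] (hν : ν ≠ 0) (hφ : Measurable φ)
    (hC : ∀ x j, |φ x j| ≤ C) (θ u : E d) (s : ℝ) :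
    law ν φ (θ + s • u) = (law ν φ θ).tilted fun x => s * inner ℝ u (φ x) := by
  rw [law_eq_tilted hν hφ hC, law_eq_tilted hν hφ hC θ,
    tilted_tilted (integrable_exp_inner hφ hC θ)]
  congr 1
  ext x
  simp [inner_add_left, inner_smul_left]

lemma cgf_law [IsFiniteMeasure ν] (hν : ν ≠ 0) (hφ : Measurable φ)
    (hC : ∀ x j, |φ x j| ≤ C) (θ u : E d) (s : ℝ) :
    cgf (fun x => inner ℝ u (φ x)) (law ν φ θ) s
      = logPartition ν φ (θ + s • u) - logPartition ν φ θ := by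
  rw [cgf, mgf, law_eq_tilted hν hφ hC, integral_exp_tilted, logPartition, logPartition,
    ← Real.log_div (integral_exp_inner_pos hν hφ hC _).ne' (integral_exp_inner_pos hν hφ hC _).ne']
  simp [inner_add_left, inner_smul_left]

/-- A bounded statistic has all exponential moments; this licenses every differentiation of the
cumulant generating function below. -/
lemma mem_interior_integrableExpSet {μ : Measure 𝒳} [IsFiniteMeasure μ] (hφ : Measurable φ)
    (hC : ∀ x j, |φ x j| ≤ C) (u : E d) (s : ℝ) :
    s ∈ interior (integrableExpSet (fun x => inner ℝ u (φ x)) μ) := by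
  have : integrableExpSet (fun x => inner ℝ u (φ x)) μ = Set.univ := by
    refine Set.eq_univ_of_forall fun t => ?_
    have := integrable_exp_inner (ν := μ) hφ hC (t • u)
    simpa [integrableExpSet, inner_smul_left] using this
  simp [this]

lemma isHermitian_covMatrix (θ : E d) : (covMatrix ν φ θ).IsHermitian := by
  ext i j
  simp [covMatrix, covariance_comm]

lemma dotProduct_covMatrix [IsFiniteMeasure ν] (hν : ν ≠ 0) (hφ : Measurable φ)
    (hC : ∀ x j, |φ x j| ≤ C) (θ : E d) (u : Fin d → ℝ) :
    u ⬝ᵥ (covMatrix ν φ θ).mulVec u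
      = variance (fun x => inner ℝ (WithLp.toLp 2 u) (φ x)) (law ν φ θ) := by
  have := isProbabilityMeasure_law hν hφ hC θ
  have hm : ∀ i, MemLp (fun x => φ x i) 2 (law ν φ θ) := fun i =>
    MemLp.of_bound (by fun_prop) C (Eventually.of_forall fun x => hC x i)
  have hm' : ∀ i, MemLp (fun x => u i * φ x i) 2 (law ν φ θ) := fun i => (hm i).const_mul _
  have hin : (fun x => inner ℝ (WithLp.toLp 2 u) (φ x)) = fun x => ∑ i, u i * φ x i := by
    ext x
    simp [PiLp.inner_apply, mul_comm]
  rw [hin, ← covariance_self (by fun_prop), covariance_fun_sum_fun_sum hm' hm']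
  simp only [dotProduct, Matrix.mulVec, covMatrix, Matrix.of_apply, Finset.mul_sum,
    covariance_const_mul_left, covariance_const_mul_right]
  refine Finset.sum_congr rfl fun i _ => Finset.sum_congr rfl fun j _ => by ring

lemma eigenvalue_covMatrix_nonneg [IsFiniteMeasure ν] (hν : ν ≠ 0) (hφ : Measurable φ)
    (hC : ∀ x j, |φ x j| ≤ C) (θ : E d) {c : ℝ}
    (hc : Module.End.HasEigenvalue (Matrix.toLin' (covMatrix ν φ θ)) c) : 0 ≤ c := by
  obtain ⟨v, hv⟩ := hc.exists_hasEigenvector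
  have h1 := hv.apply_eq_smul
  rw [Matrix.toLin'_apply] at h1
  have h2 := dotProduct_covMatrix hν hφ hC θ v
  rw [h1, dotProduct_smul, smul_eq_mul] at h2
  have h3 : 0 < v ⬝ᵥ v := by
    refine lt_of_le_of_ne (Finset.sum_nonneg fun i _ => mul_self_nonneg _) fun h => hv.2 ?_
    exact dotProduct_self_eq_zero.1 h.symm
  have h4 := variance_nonneg (fun x => inner ℝ (WithLp.toLp 2 v) (φ x)) (law ν φ θ)
  rw [← h2] at h4
  exact nonneg_of_mul_nonneg_left h4 h3

/-- Also covers `d = 0`, where the set of eigenvalues is empty and its `sInf` is `0`. -/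
lemma minEigenvalue_nonneg [IsFiniteMeasure ν] (hν : ν ≠ 0) (hφ : Measurable φ)
    (hC : ∀ x j, |φ x j| ≤ C) (θ : E d) : 0 ≤ minEigenvalue ν φ θ :=
  Real.sInf_nonneg fun _ hc => eigenvalue_covMatrix_nonneg hν hφ hC θ hc

lemma minEigenvalue_mul_le_variance [IsFiniteMeasure ν] (hν : ν ≠ 0) (hφ : Measurable φ)
    (hC : ∀ x j, |φ x j| ≤ C) (θ u : E d) :
    minEigenvalue ν φ θ * ‖u‖ ^ 2 ≤ variance (fun x => inner ℝ u (φ x)) (law ν φ θ) := by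
  set A := covMatrix ν φ θ with hA
  set c := minEigenvalue ν φ θ with hc
  have hH : (A - c • (1 : Matrix (Fin d) (Fin d) ℝ)).IsHermitian := by
    refine (isHermitian_covMatrix θ).sub ?_
    ext i j
    simp [Matrix.one_apply, eq_comm]
  have hpos : (A - c • (1 : Matrix (Fin d) (Fin d) ℝ)).PosSemidef := by
    rw [hH.posSemidef_iff_eigenvalues_nonneg]
    intro i
    have h1 := hH.mulVec_eigenvectorBasis i
    have hne : ((hH.eigenvectorBasis i).ofLp : Fin d → ℝ) ≠ 0 := by
      intro h0
      have := hH.eigenvectorBasis.orthonormal.ne_zero i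
      exact this (by ext j; exact congrFun h0 j)
    -- An eigenvalue of `A - c • 1` shifted by `c` is an eigenvalue of `A`, hence at least the
    -- minimum `c`.
    have hev : Module.End.HasEigenvalue (Matrix.toLin' A) (hH.eigenvalues i + c) := by
      refine Module.End.hasEigenvalue_of_hasEigenvector (x := (hH.eigenvectorBasis i).ofLp)
        ⟨Module.End.mem_eigenspace_iff.2 ?_, hne⟩
      rw [Matrix.toLin'_apply]
      rw [Matrix.sub_mulVec, Matrix.smul_mulVec, Matrix.one_mulVec] at h1
      rw [add_smul, ← h1]
      simp
    have hle : c ≤ hH.eigenvalues i + c :=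
      csInf_le ⟨0, fun _ h => eigenvalue_covMatrix_nonneg hν hφ hC θ h⟩ hev
    simpa using hle
  have h2 := hpos.dotProduct_mulVec_nonneg u.ofLp
  have h3 := dotProduct_covMatrix hν hφ hC θ u.ofLp
  have h4 : u.ofLp ⬝ᵥ u.ofLp = ‖u‖ ^ 2 := by
    rw [EuclideanSpace.real_norm_sq_eq]
    simp [dotProduct, sq]
  rw [Matrix.sub_mulVec, Matrix.smul_mulVec, Matrix.one_mulVec, dotProduct_sub, dotProduct_smul,
    star_trivial, h4, h3, smul_eq_mul] at h2
  simpa using h2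

lemma lam_le_minEigenvalue [IsFiniteMeasure ν] (hν : ν ≠ 0) (hφ : Measurable φ)
    (hC : ∀ x j, |φ x j| ≤ C) {Θ : Set (E d)} {θ : E d} (hθ : θ ∈ Θ) :
    lam ν φ Θ ≤ minEigenvalue ν φ θ :=
  ciInf_le (f := fun θ : Θ => minEigenvalue ν φ θ)
    ⟨0, by rintro _ ⟨θ, rfl⟩; exact minEigenvalue_nonneg hν hφ hC _⟩ ⟨θ, hθ⟩

/-- The mean map `θ ↦ E_θ φ` is strongly monotone on `Θ` with constant `λ`. -/
lemma lam_mul_le_integral_sub [IsFiniteMeasure ν] (hν : ν ≠ 0) (hφ : Measurable φ)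
    (hC : ∀ x j, |φ x j| ≤ C) {Θ : Set (E d)} (hΘ : Convex ℝ Θ) {θ₀ θ₁ : E d}
    (h₀ : θ₀ ∈ Θ) (h₁ : θ₁ ∈ Θ) :
    lam ν φ Θ * ‖θ₁ - θ₀‖ ^ 2 ≤ ∫ x, inner ℝ (θ₁ - θ₀) (φ x) ∂(law ν φ θ₁)
      - ∫ x, inner ℝ (θ₁ - θ₀) (φ x) ∂(law ν φ θ₀) := by
  have := isProbabilityMeasure_law hν hφ hC θ₀
  set u := θ₁ - θ₀ with hu
  set X : 𝒳 → ℝ := fun x => inner ℝ u (φ x) with hX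
  have hint := mem_interior_integrableExpSet (μ := law ν φ θ₀) hφ hC u
  have hd1 : ∀ s, ∫ x, X x ∂(law ν φ (θ₀ + s • u)) = deriv (cgf X (law ν φ θ₀)) s := fun s => by
    rw [law_add hν hφ hC]
    exact integral_tilted_mul_self (hint s)
  have hd2 : ∀ s, variance X (law ν φ (θ₀ + s • u))
      = deriv (deriv (cgf X (law ν φ θ₀))) s := fun s => by
    have := variance_tilted_mul (hint s)
    rwa [iteratedDeriv_succ, iteratedDeriv_one, ← law_add hν hφ hC] at this
  have hdiff : Differentiable ℝ (deriv (cgf X (law ν φ θ₀))) := fun s =>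
    (analyticAt_cgf (hint s)).deriv.differentiableAt
  -- Mean value theorem for the derivative of the cumulant generating function: the slope over `[0,
  -- 1]` is the difference of means, and the derivative is a variance at an intermediate parameter,
  -- which lies in `Θ` by convexity.
  obtain ⟨s, hs, hs'⟩ := exists_deriv_eq_slope (deriv (cgf X (law ν φ θ₀))) zero_lt_one
    hdiff.continuous.continuousOn hdiff.differentiableOn
  rw [← hd1, ← hd1, ← hd2] at hs'
  have e1 : θ₀ + (1 : ℝ) • u = θ₁ := by simp [hu]
  have e0 : θ₀ + (0 : ℝ) • u = θ₀ := by simp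
  rw [e1, e0, sub_zero, div_one] at hs'
  rw [← hs']
  have hmem : θ₀ + s • u ∈ Θ := hΘ.add_smul_sub_mem h₀ h₁ ⟨hs.1.le, hs.2.le⟩
  exact (mul_le_mul_of_nonneg_right (lam_le_minEigenvalue hν hφ hC hmem) (sq_nonneg _)).trans
    (minEigenvalue_mul_le_variance hν hφ hC _ u)

/-- An interior maximum likelihood estimate matches the moments of `φ`. -/
lemma IsMLE.moment_eq [IsFiniteMeasure ν] (hν : ν ≠ 0) (hφ : Measurable φ)
    (hC : ∀ x j, |φ x j| ≤ C) {Θ : Set (E d)} {n : ℕ} (hn : 1 ≤ n) {x : Fin n → 𝒳}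
    {θhat : E d} (h : IsMLE ν φ Θ x θhat) (hint : θhat ∈ interior Θ) (u : E d) :
    (1 / n : ℝ) * ∑ i, inner ℝ u (φ (x i)) = ∫ y, inner ℝ u (φ y) ∂(law ν φ θhat) := by
  have := isProbabilityMeasure_law hν hφ hC θhat
  set X : 𝒳 → ℝ := fun x => inner ℝ u (φ x) with hX
  have hI := mem_interior_integrableExpSet (μ := law ν φ θhat) hφ hC u
  -- `F` is the log-likelihood along the line through `θhat` in direction `u`, normalised to vanish
  -- at `s = 0`.
  set F : ℝ → ℝ := fun s => (∑ i, X (x i)) * s - n * cgf X (law ν φ θhat) s with hF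
  have hFeq : ∀ s, F s = Real.log (∏ i, density ν φ (θhat + s • u) (x i))
      - Real.log (∏ i, density ν φ θhat (x i)) := by
    intro s
    have hlog : ∀ θ, Real.log (∏ i, density ν φ θ (x i))
        = ∑ i, (inner ℝ θ (φ (x i)) - logPartition ν φ θ) := fun θ => by
      rw [Real.log_prod]
      · simp only [density, Real.log_exp]
      · exact fun i _ => (Real.exp_pos _).ne'
    rw [hlog, hlog]
    simp only [ hF, cgf_law hν hφ hC, hX, inner_add_left, inner_smul_left,
      Finset.sum_sub_distrib, Finset.sum_add_distrib, Finset.sum_const, Finset.card_univ,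
      Fintype.card_fin, nsmul_eq_mul, conj_trivial, ← Finset.mul_sum]
    ring
  have hmax : IsLocalMax F 0 := by
    have hc : Tendsto (fun s : ℝ => θhat + s • u) (𝓝 0) (𝓝 θhat) := by
      have : Continuous fun s : ℝ => θhat + s • u := by fun_prop
      simpa using this.tendsto 0
    filter_upwards [hc (mem_interior_iff_mem_nhds.1 hint)] with s hs
    rw [hFeq, hFeq, zero_smul, add_zero, sub_self, sub_nonpos]
    exact Real.log_le_log (Finset.prod_pos fun i _ => Real.exp_pos _) (h.2 hs)
  have hder : HasDerivAt F ((∑ i, X (x i)) * 1 - n * deriv (cgf X (law ν φ θhat)) 0) 0 :=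
    ((hasDerivAt_id (0 : ℝ)).const_mul _).sub
      ((analyticAt_cgf (hI 0)).differentiableAt.hasDerivAt.const_mul _)
  have h0 := hmax.hasDerivAt_eq_zero hder
  have hd1 : ∫ y, X y ∂(law ν φ θhat) = deriv (cgf X (law ν φ θhat)) 0 := by
    rw [deriv_cgf_zero (hI 0)]
    simp [hX]
  rw [hd1]
  have hn' : (n : ℝ) ≠ 0 := by positivity
  field_simp
  linarith

/-- The likelihood ratio `dp_{θ*} / dp_θ`. -/
noncomputable def likelihoodRatio (ν : Measure 𝒳) (φ : 𝒳 → E d) (θstar θ : E d) (x : 𝒳) : ℝ :=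
  density ν φ θstar x / density ν φ θ x

lemma likelihoodRatio_eq (θstar θ : E d) (x : 𝒳) :
    likelihoodRatio ν φ θstar θ x = Real.exp (inner ℝ (θstar - θ) (φ x)
      - logPartition ν φ θstar + logPartition ν φ θ) := by
  rw [likelihoodRatio, density, density, ← Real.exp_sub, inner_sub_left]
  congr 1
  ring

lemma measurable_likelihoodRatio (hφ : Measurable φ) (θstar θ : E d) :
    Measurable (likelihoodRatio ν φ θstar θ) := by
  simp only [funext (likelihoodRatio_eq (ν := ν) (φ := φ) θstar θ)]
  fun_prop

lemma abs_likelihoodRatio_le (hC : ∀ x j, |φ x j| ≤ C) (θstar θ : E d) :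
    ∃ B, ∀ x, |likelihoodRatio ν φ θstar θ x| ≤ B := by
  refine ⟨Real.exp (‖θstar - θ‖ * (Real.sqrt d * C)
      - logPartition ν φ θstar + logPartition ν φ θ), fun x => ?_⟩
  rw [likelihoodRatio_eq, abs_of_pos (Real.exp_pos _), Real.exp_le_exp]
  linarith [(le_abs_self _).trans (abs_inner_le hC (θstar - θ) x)]

/-- Change of measure; densities are strictly positive, so the integrands agree pointwise and `g`
needs no integrability. -/
lemma integral_mul_likelihoodRatio [IsFiniteMeasure ν] (hν : ν ≠ 0) (hφ : Measurable φ)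
    (hC : ∀ x j, |φ x j| ≤ C) (θstar θ : E d) (g : 𝒳 → ℝ) :
    ∫ x, likelihoodRatio ν φ θstar θ x * g x ∂(law ν φ θ) = ∫ x, g x ∂(law ν φ θstar) := by
  rw [integral_law hν hφ hC, integral_law hν hφ hC]
  congr 1
  ext x
  have : density ν φ θ x ≠ 0 := (Real.exp_pos _).ne'
  rw [likelihoodRatio]
  field_simp

/-- The `χ²`-divergence of `p_{θ*}` from `p_θ`. -/
lemma integral_one_sub_likelihoodRatio_sq [IsFiniteMeasure ν] (hν : ν ≠ 0) (hφ : Measurable φ)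
    (hC : ∀ x j, |φ x j| ≤ C) (θstar θ : E d) :
    ∫ x, (1 - likelihoodRatio ν φ θstar θ x) ^ 2 ∂(law ν φ θ) = chi ν φ θstar θ ^ 2 := by
  have := isProbabilityMeasure_law hν hφ hC θ
  have := isProbabilityMeasure_law hν hφ hC θstar
  set r := likelihoodRatio ν φ θstar θ with hr
  obtain ⟨B, hB⟩ := abs_likelihoodRatio_le (ν := ν) hC θstar θ
  have hrm := measurable_likelihoodRatio (ν := ν) hφ θstar θ
  have hri : ∀ θ', Integrable r (law ν φ θ') := fun θ' =>
    have := isProbabilityMeasure_law hν hφ hC θ'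
    integrable_of_abs_le hrm hB
  have hrri : Integrable (fun x => r x * r x) (law ν φ θ) :=
    integrable_of_abs_le (B := B * B) (hrm.mul hrm) fun x => by
      rw [abs_mul]
      exact mul_le_mul (hB x) (hB x) (abs_nonneg _) ((abs_nonneg _).trans (hB x))
  have h1 : ∫ x, r x ∂(law ν φ θ) = 1 := by
    simpa using integral_mul_likelihoodRatio hν hφ hC θstar θ fun _ => 1
  have h2 : ∫ x, r x * r x ∂(law ν φ θ) = Real.exp (-2 * logPartition ν φ θstar
      + logPartition ν φ θ + logPartition ν φ ((2 : ℝ) • θstar - θ)) := by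
    rw [integral_mul_likelihoodRatio hν hφ hC, integral_law hν hφ hC, Real.exp_add,
      exp_logPartition hν hφ hC, ← integral_const_mul]
    congr 1
    ext x
    rw [hr, likelihoodRatio_eq, density, ← Real.exp_add, ← Real.exp_add]
    congr 1
    simp only [inner_sub_left, inner_smul_left, conj_trivial]
    ring
  have h3 : ∫ x, (1 - r x) ^ 2 ∂(law ν φ θ) = ∫ x, r x * r x ∂(law ν φ θ) - 1 := by
    have : (fun x => (1 - r x) ^ 2) = fun x => (1 - 2 * r x) + r x * r x := by ext x; ring
    have hi : Integrable (fun x => 1 - 2 * r x) (law ν φ θ) :=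
      (integrable_const _).sub ((hri θ).const_mul 2)
    rw [this, integral_add hi hrri,
      integral_sub (integrable_const _) ((hri θ).const_mul 2), integral_const_mul, h1]
    simp
    ring
  -- As the integral of a square, the radicand in `chi` is nonnegative, so the square root is not
  -- truncated.
  have h4 : 0 ≤ ∫ x, (1 - r x) ^ 2 ∂(law ν φ θ) := integral_nonneg fun x => sq_nonneg _
  rw [h3, h2] at h4
  rw [h3, h2, chi, Real.sq_sqrt h4]

lemma chi_nonneg (θstar θ : E d) : 0 ≤ chi ν φ θstar θ := Real.sqrt_nonneg _

lemma chi_self (θstar : E d) : chi ν φ θstar θstar = 0 := by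
  rw [chi, two_smul, add_sub_cancel_right]
  have : -2 * logPartition ν φ θstar + logPartition ν φ θstar + logPartition ν φ θstar = 0 := by
    ring
  rw [this]
  simp

/-- `chi` vanishes at `θstar`, so the Lipschitz bound becomes a bound on its size. -/
lemma chi_le {L : ℝ≥0} {Θ : Set (E d)} {θstar θ : E d}
    (hL : LipschitzOnWith L (chi ν φ θstar) Θ) (hstar : θstar ∈ Θ) (hθ : θ ∈ Θ) :
    chi ν φ θstar θ ≤ L * ‖θ - θstar‖ := by
  have := hL.dist_le_mul θ hθ θstar hstar
  rwa [chi_self, Real.dist_eq, sub_zero, abs_of_nonneg (chi_nonneg _ _), dist_eq_norm] at this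

end Family

/-! ### Markov kernels: contraction on mean-zero functions and the bias of `m` steps. -/

section Kernels

variable {𝒳 : Type*} [MeasurableSpace 𝒳] {d : ℕ}

lemma isMarkovKernel_pow (κ : Kernel 𝒳 𝒳) [IsMarkovKernel κ] (m : ℕ) :
    IsMarkovKernel (κ ^ m) := by
  induction m with
  | zero => exact inferInstanceAs (IsMarkovKernel (Kernel.id : Kernel 𝒳 𝒳))
  | succ m ih =>
    rw [Kernel.pow_add, pow_one]
    infer_instance

lemma measurable_integral_kernel (κ : Kernel 𝒳 𝒳) [IsMarkovKernel κ] {f : 𝒳 → ℝ}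
    (hf : Measurable f) : Measurable fun x => ∫ y, f y ∂(κ x) :=
  (hf.stronglyMeasurable.integral_kernel (κ := κ)).measurable

lemma abs_integral_le_of_abs_le {μ : Measure 𝒳} [IsProbabilityMeasure μ] {f : 𝒳 → ℝ} {B : ℝ}
    (hB : ∀ x, |f x| ≤ B) : |∫ y, f y ∂μ| ≤ B := by
  simpa using norm_integral_le_of_norm_le_const (μ := μ) (f := f) (C := B) (Eventually.of_forall hB)

lemma integral_bind_kernel (κ : Kernel 𝒳 𝒳) [IsMarkovKernel κ] (μ : Measure 𝒳)
    [IsProbabilityMeasure μ] {f : 𝒳 → ℝ} {B : ℝ} (hf : Measurable f) (hB : ∀ x, |f x| ≤ B) :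
    ∫ y, f y ∂(μ.bind κ) = ∫ x, ∫ y, f y ∂(κ x) ∂μ := by
  rw [Measure.comp_eq_comp_const_apply, Kernel.integral_comp (integrable_of_abs_le hf hB),
    Kernel.const_apply]

lemma integral_kernel_pow_succ (κ : Kernel 𝒳 𝒳) [IsMarkovKernel κ] (m : ℕ) {f : 𝒳 → ℝ} {B : ℝ}
    (hf : Measurable f) (hB : ∀ x, |f x| ≤ B) (x : 𝒳) :
    ∫ y, f y ∂((κ ^ (m + 1)) x) = ∫ z, ∫ y, f y ∂((κ ^ m) z) ∂(κ x) := by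
  have := isMarkovKernel_pow κ m
  rw [Kernel.pow_add, pow_one, Kernel.integral_comp (integrable_of_abs_le hf hB)]

lemma eLpNorm_two_eq {μ : Measure 𝒳} [IsFiniteMeasure μ] {f : 𝒳 → ℝ} {B : ℝ}
    (hf : Measurable f) (hB : ∀ x, |f x| ≤ B) :
    eLpNorm f 2 μ = ENNReal.ofReal √(∫ x, f x ^ 2 ∂μ) := by
  have hm : MemLp f 2 μ := MemLp.of_bound hf.aestronglyMeasurable B (Eventually.of_forall hB)
  rw [hm.eLpNorm_eq_integral_rpow_norm (by norm_num) (by norm_num), Real.sqrt_eq_rpow]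
  congr 2 <;> norm_num

lemma abs_integral_mul_le {μ : Measure 𝒳} [IsFiniteMeasure μ] {f g : 𝒳 → ℝ} {A B : ℝ}
    (hf : Measurable f) (hA : ∀ x, |f x| ≤ A) (hg : Measurable g) (hB : ∀ x, |g x| ≤ B) :
    |∫ x, f x * g x ∂μ| ≤ √(∫ x, f x ^ 2 ∂μ) * √(∫ x, g x ^ 2 ∂μ) := by
  have hfm : MemLp f (ENNReal.ofReal 2) μ :=
    MemLp.of_bound hf.aestronglyMeasurable A (Eventually.of_forall hA)
  have hgm : MemLp g (ENNReal.ofReal 2) μ :=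
    MemLp.of_bound hg.aestronglyMeasurable B (Eventually.of_forall hB)
  have h := integral_mul_norm_le_Lp_mul_Lq Real.HolderConjugate.two_two hfm hgm
  simp only [Real.norm_eq_abs, Real.rpow_ofNat, sq_abs, ← Real.sqrt_eq_rpow] at h
  refine (abs_integral_le_integral_abs).trans ?_
  simpa only [abs_mul] using h

/-- `l2Norm` tests only functions of norm at most one. Since `f` may vanish in `L²`, it is scaled by
an arbitrary positive `r` above its norm, and `r` then decreases to the norm. -/
lemma sqrt_integral_kernel_sq_le (κ : Kernel 𝒳 𝒳) [IsMarkovKernel κ] (π : Measure 𝒳)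
    [IsProbabilityMeasure π] {a : ℝ} (ha : 0 ≤ a) (hκ : l2Norm κ π ≤ ENNReal.ofReal a)
    {f : 𝒳 → ℝ} {B : ℝ} (hf : Measurable f) (hB : ∀ x, |f x| ≤ B) (h0 : ∫ x, f x ∂π = 0) :
    √(∫ x, (∫ y, f y ∂(κ x)) ^ 2 ∂π) ≤ a * √(∫ x, f x ^ 2 ∂π) := by
  have key : ∀ r : ℝ, √(∫ x, f x ^ 2 ∂π) ≤ r → 0 < r →
      √(∫ x, (∫ y, f y ∂(κ x)) ^ 2 ∂π) ≤ a * r := by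
    intro r hr hr0
    have hgB : ∀ x, |r⁻¹ * f x| ≤ r⁻¹ * B := fun x => by
      rw [abs_mul, abs_of_pos (inv_pos.2 hr0)]
      exact mul_le_mul_of_nonneg_left (hB x) (inv_pos.2 hr0).le
    have hgm : Measurable fun x => r⁻¹ * f x := hf.const_mul _
    have hscale : ∀ g : 𝒳 → ℝ, √(∫ x, (r⁻¹ * g x) ^ 2 ∂π) = r⁻¹ * √(∫ x, g x ^ 2 ∂π) := by
      intro g
      simp only [mul_pow, integral_const_mul]
      rw [Real.sqrt_mul (by positivity), Real.sqrt_sq (inv_pos.2 hr0).le]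
    have h1 : eLpNorm (fun x => r⁻¹ * f x) 2 π ≤ 1 := by
      rw [eLpNorm_two_eq hgm hgB, hscale, ← ENNReal.ofReal_one]
      refine ENNReal.ofReal_le_ofReal ?_
      rw [inv_mul_le_iff₀ hr0]
      simpa using hr
    have h2 : eLpNorm (fun x => ∫ y, r⁻¹ * f y ∂(κ x)) 2 π ≤ l2Norm κ π := by
      rw [l2Norm]
      refine le_iSup_of_le (fun x => r⁻¹ * f x) (le_iSup_of_le
        (MemLp.of_bound hgm.aestronglyMeasurable _ (Eventually.of_forall hgB))
        (le_iSup_of_le ?_ (le_iSup_of_le h1 le_rfl)))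
      rw [integral_const_mul, h0, mul_zero]
    have h3 := h2.trans hκ
    rw [eLpNorm_two_eq (measurable_integral_kernel κ hgm)
      (fun x => abs_integral_le_of_abs_le hgB), ENNReal.ofReal_le_ofReal_iff ha] at h3
    simp only [integral_const_mul] at h3
    rw [hscale, inv_mul_le_iff₀ hr0] at h3
    linarith
  refine le_of_forall_pos_le_add fun ε hε => ?_
  -- The excess `ε / (a + 1)` costs at most `ε` after multiplication by `a`, including when `a = 0`.
  have h := key (√(∫ x, f x ^ 2 ∂π) + ε / (a + 1)) (by linarith [div_pos hε (by linarith : 0 < a + 1)])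
    (by positivity)
  have h' : a * (ε / (a + 1)) ≤ ε := by
    rw [mul_div_assoc', div_le_iff₀ (by positivity)]
    nlinarith
  linarith

lemma integral_kernel_pow_invariant (κ : Kernel 𝒳 𝒳) [IsMarkovKernel κ] (π : Measure 𝒳)
    [IsProbabilityMeasure π] (hinv : Kernel.Invariant κ π) (m : ℕ) {f : 𝒳 → ℝ} {B : ℝ}
    (hf : Measurable f) (hB : ∀ x, |f x| ≤ B) :
    ∫ x, ∫ y, f y ∂((κ ^ m) x) ∂π = ∫ x, f x ∂π := by
  induction m with
  | zero =>
    have : ∀ x, ∫ y, f y ∂((κ ^ 0) x) = f x := fun x => by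
      rw [pow_zero]
      change ∫ y, f y ∂(Kernel.id x) = f x
      rw [Kernel.id_apply, integral_dirac' _ _ hf.stronglyMeasurable]
    simp only [this]
  | succ m ih =>
    have := isMarkovKernel_pow κ m
    rw [← ih]
    simp only [integral_kernel_pow_succ κ m hf hB]
    rw [← integral_bind_kernel κ π (measurable_integral_kernel _ hf)
      (fun x => abs_integral_le_of_abs_le hB), hinv.def]

/-- Invariance keeps the iterates mean-zero, so the one-step contraction can be repeated. -/
lemma sqrt_integral_kernel_pow_sq_le (κ : Kernel 𝒳 𝒳) [IsMarkovKernel κ] (π : Measure 𝒳)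
    [IsProbabilityMeasure π] (hinv : Kernel.Invariant κ π)
    {a : ℝ} (ha : 0 ≤ a) (hκ : l2Norm κ π ≤ ENNReal.ofReal a) (m : ℕ)
    {f : 𝒳 → ℝ} {B : ℝ} (hf : Measurable f) (hB : ∀ x, |f x| ≤ B) (h0 : ∫ x, f x ∂π = 0) :
    √(∫ x, (∫ y, f y ∂((κ ^ m) x)) ^ 2 ∂π) ≤ a ^ m * √(∫ x, f x ^ 2 ∂π) := by
  induction m with
  | zero =>
    have : ∀ x, ∫ y, f y ∂((κ ^ 0) x) = f x := fun x => by
      rw [pow_zero]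
      change ∫ y, f y ∂(Kernel.id x) = f x
      rw [Kernel.id_apply, integral_dirac' _ _ hf.stronglyMeasurable]
    simp only [this]
    simp
  | succ m ih =>
    have := isMarkovKernel_pow κ m
    simp only [integral_kernel_pow_succ κ m hf hB]
    refine (sqrt_integral_kernel_sq_le κ π ha hκ (measurable_integral_kernel _ hf)
      (fun x => abs_integral_le_of_abs_le hB) ?_).trans ?_
    · rw [integral_kernel_pow_invariant κ π hinv m hf hB, h0]
    · rw [pow_succ', mul_assoc]
      exact mul_le_mul_of_nonneg_left ih ha

/-- The bias of `m` steps of the chain started from `p_{θ*}` instead of the invariant law `p_θ`. -/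
lemma abs_integral_law_sub_le {ν : Measure 𝒳} [IsFiniteMeasure ν] {φ : 𝒳 → E d} {C : ℝ}
    (hν : ν ≠ 0) (hφ : Measurable φ) (hC : ∀ x j, |φ x j| ≤ C) (θstar θ : E d)
    (κ : Kernel 𝒳 𝒳) [IsMarkovKernel κ] (hinv : Kernel.Invariant κ (law ν φ θ))
    {a : ℝ} (ha : 0 ≤ a) (hκ : l2Norm κ (law ν φ θ) ≤ ENNReal.ofReal a) (m : ℕ)
    {f : 𝒳 → ℝ} {B : ℝ} (hf : Measurable f) (hB0 : 0 ≤ B) (hB : ∀ x, |f x| ≤ B) :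
    |∫ x, f x ∂(law ν φ θ) - ∫ y, f y ∂((law ν φ θstar).bind (κ ^ m))|
      ≤ a ^ m * B * chi ν φ θstar θ := by
  have := isProbabilityMeasure_law hν hφ hC θ
  have := isProbabilityMeasure_law hν hφ hC θstar
  have := isMarkovKernel_pow κ m
  set π := law ν φ θ with hπ
  set r := likelihoodRatio ν φ θstar θ with hr
  obtain ⟨R, hR⟩ := abs_likelihoodRatio_le (ν := ν) hC θstar θ
  have hrm := measurable_likelihoodRatio (ν := ν) hφ θstar θ
  set c := ∫ x, f x ∂π with hc
  have hcB : |c| ≤ B := abs_integral_le_of_abs_le hB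
  have hgm : Measurable fun x => f x - c := hf.sub_const c
  have hgB : ∀ x, |f x - c| ≤ B + B := fun x => (abs_sub _ _).trans (add_le_add (hB x) hcB)
  have hfi : ∀ (μ : Measure 𝒳) [IsProbabilityMeasure μ], Integrable f μ := fun μ _ =>
    integrable_of_abs_le hf hB
  have hg0 : ∫ x, (f x - c) ∂π = 0 := by
    rw [integral_sub (hfi π) (integrable_const _)]
    simp [hc]
  -- Centring decreases the second moment, giving `B` rather than the pointwise bound `B + B`.
  have hgvar : √(∫ x, (f x - c) ^ 2 ∂π) ≤ B := by
    have h1 : ∫ x, (f x - c) ^ 2 ∂π ≤ ∫ x, f x ^ 2 ∂π := by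
      have h := variance_le_expectation_sq (μ := π) hf.aestronglyMeasurable
      rwa [variance_eq_integral hf.aemeasurable] at h
    refine (Real.sqrt_le_sqrt h1).trans (Real.sqrt_le_iff.2 ⟨hB0, ?_⟩)
    refine (le_abs_self _).trans (abs_integral_le_of_abs_le fun x => ?_)
    rw [abs_of_nonneg (sq_nonneg _), ← sq_abs]
    exact pow_le_pow_left₀ (abs_nonneg _) (hB x) 2
  set G : 𝒳 → ℝ := fun x => ∫ y, (f y - c) ∂((κ ^ m) x) with hG
  have hGm : Measurable G := measurable_integral_kernel _ hgm
  have hGB : ∀ x, |G x| ≤ B + B := fun x => abs_integral_le_of_abs_le hgB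
  have hGi : ∀ (μ : Measure 𝒳) [IsProbabilityMeasure μ], Integrable G μ := fun μ _ =>
    integrable_of_abs_le hGm hGB
  -- The bias as an inner product in `L²(π)`: `G` has `π`-mean zero, and weighting by `r` changes
  -- `π` to `p_θstar`. Cauchy–Schwarz then separates the χ-distance from the contraction.
  have h1 : ∫ x, (1 - r x) * G x ∂π
      = c - ∫ y, f y ∂((law ν φ θstar).bind (κ ^ m)) := by
    have hrG : Integrable (fun x => r x * G x) π :=
      integrable_of_abs_le (B := R * (B + B)) (hrm.mul hGm) fun x => by
        rw [abs_mul]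
        exact mul_le_mul (hR x) (hGB x) (abs_nonneg _) ((abs_nonneg _).trans (hR x))
    have : ∀ x, (1 - r x) * G x = G x - r x * G x := fun x => by ring
    simp only [this]
    rw [integral_sub (hGi π) hrG, integral_mul_likelihoodRatio hν hφ hC,
      integral_kernel_pow_invariant κ π hinv m hgm hgB, hg0,
      ← integral_bind_kernel _ _ hgm hgB, integral_sub (hfi _) (integrable_const _)]
    simp
  rw [← h1]
  have h1r : ∀ x, |1 - r x| ≤ 1 + R := fun x => by
    refine (abs_sub _ _).trans ?_
    rw [abs_one]
    linarith [hR x]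
  refine (abs_integral_mul_le (hrm.const_sub 1) h1r hGm hGB).trans ?_
  rw [integral_one_sub_likelihoodRatio_sq hν hφ hC, Real.sqrt_sq (chi_nonneg _ _), mul_comm]
  refine mul_le_mul_of_nonneg_right ?_ (chi_nonneg _ _)
  exact (sqrt_integral_kernel_pow_sq_le κ π hinv ha hκ m hgm hgB hg0).trans
    (mul_le_mul_of_nonneg_left hgvar (pow_nonneg ha m))

lemma l2Norm_le_alpha {ν : Measure 𝒳} {φ : 𝒳 → E d} {Θ : Set (E d)} {k : E d → Kernel 𝒳 𝒳}
    (hgap : alpha ν φ Θ k < 1) {θ : E d} (hθ : θ ∈ Θ) :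
    l2Norm (k θ) (law ν φ θ) ≤ ENNReal.ofReal (alpha ν φ Θ k).toReal := by
  rw [ENNReal.ofReal_toReal (hgap.trans ENNReal.one_lt_top).ne]
  exact le_iSup₂ (f := fun θ (_ : θ ∈ Θ) => l2Norm (k θ) (law ν φ θ)) θ hθ

end Kernels

/-! ### Conditional expectations from conditional laws. -/

section CondExp

variable {Ω 𝒳 : Type*} {m mΩ : MeasurableSpace Ω} [MeasurableSpace 𝒳] {P : Measure Ω}
  [IsProbabilityMeasure P]

/-- Conditional expectations of bounded functions of `Z`, from the conditional law of `Z`. -/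
lemma condExp_comp_ae_eq (hm : m ≤ mΩ) {Z : Ω → 𝒳} (hZ : Measurable Z) {q : Ω → Measure 𝒳}
    (hq : ∀ ω, IsProbabilityMeasure (q ω))
    (hlaw : ∀ S : Set 𝒳, MeasurableSet S →
      P[(Z ⁻¹' S).indicator (fun _ => (1 : ℝ)) | m] =ᵐ[P] fun ω => (q ω).real S)
    {f : 𝒳 → ℝ} {B : ℝ} (hf : Measurable f) (hB : ∀ x, |f x| ≤ B) :
    P[fun ω => f (Z ω) | m] =ᵐ[P] fun ω => ∫ y, f y ∂(q ω) := by
  have hsimple : ∀ s : SimpleFunc 𝒳 ℝ,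
      P[fun ω => s (Z ω) | m] =ᵐ[P] fun ω => ∫ y, s y ∂(q ω) := by
    intro s
    have hint : ∀ (s : SimpleFunc 𝒳 ℝ), Integrable (fun ω => s (Z ω)) P := fun s =>
      (SimpleFunc.integrable_of_isFiniteMeasure (s.comp Z hZ) : Integrable (s.comp Z hZ) P)
    induction s using SimpleFunc.induction with
    | const c hs =>
      rename_i S
      have h1 : (fun ω => (SimpleFunc.piecewise S hs (SimpleFunc.const 𝒳 c)
          (SimpleFunc.const 𝒳 0)) (Z ω)) = c • (Z ⁻¹' S).indicator (fun _ => (1 : ℝ)) := by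
        ext ω
        by_cases h : Z ω ∈ S <;> simp [h]
      rw [h1]
      filter_upwards [condExp_smul (μ := P) c ((Z ⁻¹' S).indicator (fun _ => (1 : ℝ))) m,
        hlaw S hs] with ω h2 h3
      rw [h2, Pi.smul_apply, h3]
      simp [SimpleFunc.coe_piecewise, integral_indicator hs, Set.piecewise_eq_indicator, mul_comm]
    | add hfg ihf ihg =>
      rename_i f g
      filter_upwards [condExp_add (hint f) (hint g) m, ihf, ihg] with ω h1 h2 h3
      have := hq ω
      have e : ∫ y, (f + g) y ∂(q ω) = ∫ y, f y ∂(q ω) + ∫ y, g y ∂(q ω) :=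
        integral_add (SimpleFunc.integrable_of_isFiniteMeasure f)
          (SimpleFunc.integrable_of_isFiniteMeasure g)
      rw [e, ← h2, ← h3]
      exact h1
  set s : ℕ → SimpleFunc 𝒳 ℝ := hf.stronglyMeasurable.approxBounded B with hs
  rcases isEmpty_or_nonempty 𝒳 with h𝒳 | ⟨⟨x₀⟩⟩
  · have : IsEmpty Ω := ⟨fun ω => h𝒳.false (Z ω)⟩
    exact Eventually.of_forall fun ω => this.elim ω
  have hB0 : 0 ≤ B := (abs_nonneg _).trans (hB x₀)
  have hsB : ∀ n x, ‖s n x‖ ≤ B := fun n x => hf.stronglyMeasurable.norm_approxBounded_le hB0 n x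
  have hst : ∀ x, Tendsto (fun n => s n x) atTop (𝓝 (f x)) := fun x =>
    hf.stronglyMeasurable.tendsto_approxBounded_of_norm_le (hB x)
  have hgt : ∀ ω, Tendsto (fun n => ∫ y, s n y ∂(q ω)) atTop (𝓝 (∫ y, f y ∂(q ω))) := fun ω => by
    have := hq ω
    exact tendsto_integral_of_dominated_convergence (fun _ => B)
      (fun n => (s n).measurable.aestronglyMeasurable) (integrable_const _)
      (fun n => Eventually.of_forall (hsB n)) (Eventually.of_forall hst)
  have hgm : ∀ n, AEStronglyMeasurable[m] (fun ω => ∫ y, s n y ∂(q ω)) P := fun n =>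
    ⟨_, stronglyMeasurable_condExp, (hsimple (s n)).symm⟩
  have hgB : ∀ n ω, ‖∫ y, s n y ∂(q ω)‖ ≤ B := fun n ω => by
    have := hq ω
    exact abs_integral_le_of_abs_le (hsB n)
  have hgi : ∀ n, Integrable (fun ω => ∫ y, s n y ∂(q ω)) P := fun n =>
    Integrable.of_bound ((hgm n).mono hm) B (Eventually.of_forall (hgB n))
  -- `q` is not assumed to be a kernel, so measurability of the limit comes from the conditional
  -- expectations of the simple approximations.
  have hlim : AEStronglyMeasurable[m] (fun ω => ∫ y, f y ∂(q ω)) P := by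
    have hG : StronglyMeasurable[m]
        fun ω => limUnder atTop fun n => (P[fun ω => s n (Z ω) | m]) ω :=
      @StronglyMeasurable.limUnder _ _ _ m _ _ _ _ _ _ _ fun n => stronglyMeasurable_condExp
    refine ⟨_, hG, ?_⟩
    filter_upwards [ae_all_iff.2 fun n => hsimple (s n)] with ω hω
    exact (((hgt ω).congr fun n => (hω n).symm).limUnder_eq).symm
  have hlimi : Integrable (fun ω => ∫ y, f y ∂(q ω)) P :=
    Integrable.of_bound (hlim.mono hm) B (Eventually.of_forall fun ω => by
      have := hq ω
      exact abs_integral_le_of_abs_le hB)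
  refine (tendsto_condExp_unique (fun n ω => s n (Z ω)) (fun n ω => ∫ y, s n y ∂(q ω)) _ _
    (fun n => Integrable.of_bound ((s n).measurable.comp hZ).aestronglyMeasurable B
      (Eventually.of_forall fun ω => hsB n _)) hgi (Eventually.of_forall fun ω => hst (Z ω))
    (Eventually.of_forall hgt) (fun _ => B) (integrable_const _) (fun _ => B) (integrable_const _)
    (fun n => Eventually.of_forall fun ω => hsB n _) (fun n => Eventually.of_forall (hgB n))
    fun n => ?_).trans (condExp_of_aestronglyMeasurable' hm hlim hlimi)
  exact (hsimple (s n)).trans (condExp_of_aestronglyMeasurable' hm (hgm n) (hgi n)).symm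

end CondExp

/-! ### Almost sure convergence of the martingale noise. -/

section Martingale

variable {Ω : Type*} {mΩ : MeasurableSpace Ω} {P : Measure Ω} [IsProbabilityMeasure P]
  {ℱ : Filtration ℕ mΩ}

/-- The compensated sums of an adapted sequence with square-summable bounds converge. -/
lemma ae_exists_tendsto_sum_sub_condExp {W : ℕ → Ω → ℝ} {c : ℕ → ℝ}
    (hW : ∀ t, StronglyMeasurable[ℱ (t + 1)] (W t)) (hWc : ∀ t ω, |W t ω| ≤ c t)
    (hc : Summable fun t => c t ^ 2) :
    ∀ᵐ ω ∂P, ∃ l, Tendsto (fun T => ∑ s ∈ Finset.range T, (W s ω - (P[W s | ℱ s]) ω))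
      atTop (𝓝 l) := by
  set D : ℕ → Ω → ℝ := fun s => W s - P[W s | ℱ s] with hD
  set M : ℕ → Ω → ℝ := fun T => ∑ s ∈ Finset.range T, D s with hM
  have hWi : ∀ t, Integrable (W t) P := fun t =>
    Integrable.of_bound ((hW t).mono (ℱ.le _)).aestronglyMeasurable (c t)
      (Eventually.of_forall (hWc t))
  have hDm : ∀ t, StronglyMeasurable[ℱ (t + 1)] (D t) := fun t =>
    (hW t).sub (stronglyMeasurable_condExp.mono (ℱ.mono (Nat.le_succ t)))
  have hDc : ∀ t, ∀ᵐ ω ∂P, |D t ω| ≤ 2 * c t := fun t => by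
    have h := ae_bdd_abs_condExp_of_ae_bdd_abs (m := ℱ t)
      (Eventually.of_forall (hWc t) : ∀ᵐ ω ∂P, |W t ω| ≤ c t)
    filter_upwards [h] with ω hω
    calc |W t ω - (P[W t | ℱ t]) ω| ≤ |W t ω| + |(P[W t | ℱ t]) ω| := abs_sub _ _
      _ ≤ 2 * c t := by linarith [hWc t ω]
  have hDi : ∀ t, Integrable (D t) P := fun t => (hWi t).sub integrable_condExp
  have hDp : ∀ t, MemLp (D t) 2 P := fun t =>
    MemLp.of_bound ((hDm t).mono (ℱ.le _)).aestronglyMeasurable (2 * c t) (hDc t)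
  have hMm : ∀ T, StronglyMeasurable[ℱ T] (M T) := fun T =>
    Finset.stronglyMeasurable_sum _ fun s hs =>
      (hDm s).mono (ℱ.mono (Nat.succ_le_of_lt (Finset.mem_range.1 hs)))
  have hMp : ∀ T, MemLp (M T) 2 P := fun T => memLp_finsetSum' _ fun s _ => hDp s
  have hMi : ∀ T, Integrable (M T) P := fun T => (hMp T).integrable (by norm_num)
  have hDz : ∀ t, P[D t | ℱ t] =ᵐ[P] 0 := fun t => by
    filter_upwards [condExp_sub (hWi t) integrable_condExp (ℱ t),
      condExp_condExp_of_le (μ := P) (f := W t) (le_refl (ℱ t)) (ℱ.le t)] with ω h1 h2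
    rw [hD, h1, Pi.sub_apply, h2, sub_self, Pi.zero_apply]
  have hMs : ∀ T, M (T + 1) = M T + D T := fun T => Finset.sum_range_succ _ _
  have hmart : Martingale M ℱ P := by
    refine martingale_nat hMm hMi fun T => ?_
    rw [hMs]
    filter_upwards [condExp_add (hMi T) (hDi T) (ℱ T), hDz T] with ω h1 h2
    rw [h1, Pi.add_apply, h2, condExp_of_stronglyMeasurable (ℱ.le T) (hMm T) (hMi T),
      Pi.zero_apply, add_zero]
  have hMD : ∀ T, Integrable (M T * D T) P := fun T => (hMp T).integrable_mul (hDp T)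
  -- Orthogonality of the increments makes second moments add up, so `M` is bounded in `L²`, hence
  -- in `L¹` as Doob's convergence theorem requires.
  have horth : ∀ T, ∫ ω, M T ω * D T ω ∂P = 0 := fun T => by
    have h1 := integral_condExp (μ := P) (f := M T * D T) (ℱ.le T)
    have h2 : P[M T * D T | ℱ T] =ᵐ[P] 0 := by
      filter_upwards [condExp_mul_of_stronglyMeasurable_left (hMm T) (hMD T) (hDi T), hDz T]
        with ω h3 h4
      rw [h3, Pi.mul_apply, h4, Pi.zero_apply, mul_zero]
    rw [integral_congr_ae h2] at h1
    simpa using h1.symm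
  have hsq : ∀ T, ∫ ω, M T ω ^ 2 ∂P ≤ ∑ s ∈ Finset.range T, 4 * c s ^ 2 := fun T => by
    induction T with
    | zero => simp [hM]
    | succ T ih =>
      have e : ∀ ω, M (T + 1) ω ^ 2 = M T ω ^ 2 + 2 * (M T ω * D T ω) + D T ω ^ 2 := fun ω => by
        rw [hMs, Pi.add_apply]
        ring
      have i1 : Integrable (fun ω => M T ω ^ 2) P := (hMp T).integrable_sq
      have i2 : Integrable (fun ω => 2 * (M T ω * D T ω)) P := (hMD T).const_mul 2
      have i3 : Integrable (fun ω => D T ω ^ 2) P := (hDp T).integrable_sq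
      have i4 : Integrable (fun ω => M T ω ^ 2 + 2 * (M T ω * D T ω)) P := i1.add i2
      simp only [e]
      rw [integral_add i4 i3, integral_add i1 i2, integral_const_mul, horth,
        Finset.sum_range_succ]
      have h5 : ∫ ω, D T ω ^ 2 ∂P ≤ 4 * c T ^ 2 := by
        have : ∫ ω, D T ω ^ 2 ∂P ≤ ∫ _ω, 4 * c T ^ 2 ∂P := by
          refine integral_mono_ae i3 (integrable_const _) ?_
          filter_upwards [hDc T] with ω hω
          have := pow_le_pow_left₀ (abs_nonneg _) hω 2
          rw [sq_abs] at this
          linarith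
        simpa using this
      linarith
  have hbd : ∀ T, eLpNorm (M T) 1 P ≤ (Real.toNNReal √(∑' s, 4 * c s ^ 2) : ℝ≥0) := fun T => by
    refine (eLpNorm_le_eLpNorm_of_exponent_le one_le_two
      (hMp T).aestronglyMeasurable).trans ?_
    rw [(hMp T).eLpNorm_eq_integral_rpow_norm (by norm_num) (by norm_num)]
    refine ENNReal.ofReal_le_ofReal ?_
    have e : (∫ ω, ‖M T ω‖ ^ (2 : ℝ≥0∞).toReal ∂P) ^ ((2 : ℝ≥0∞).toReal)⁻¹
        = √(∫ ω, M T ω ^ 2 ∂P) := by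
      rw [Real.sqrt_eq_rpow]
      norm_num
    rw [e]
    exact Real.sqrt_le_sqrt ((hsq T).trans
      ((hc.mul_left 4).sum_le_tsum _ fun s _ => by positivity))
  filter_upwards [hmart.submartingale.ae_tendsto_limitProcess hbd] with ω hω
  refine ⟨_, hω.congr fun T => ?_⟩
  simp [hM, hD]

end Martingale

/-! ### The CD iteration: confinement to `Θ` and conditional mean of a step. -/

section Algorithm

variable {𝒳 : Type*} [MeasurableSpace 𝒳] {d : ℕ} {φ : 𝒳 → E d} {C : ℝ} {Θ : Set (E d)}
  {k : E d → Kernel 𝒳 𝒳} {m : ℕ} {η : ℕ → ℝ} {n : ℕ} {x : Fin n → 𝒳}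

lemma norm_average_le {v : Fin n → E d} {B : ℝ} (hB0 : 0 ≤ B) (hv : ∀ i, ‖v i‖ ≤ B) :
    ‖(1 / n : ℝ) • ∑ i, v i‖ ≤ B := by
  rw [norm_smul, Real.norm_of_nonneg (by positivity)]
  have h : ‖∑ i, v i‖ ≤ n * B := by
    simpa using norm_sum_le_of_le Finset.univ fun i _ => hv i
  rcases Nat.eq_zero_or_pos n with rfl | hn
  · simpa using hB0
  · have hn' : (0 : ℝ) < n := by exact_mod_cast hn
    rw [one_div, inv_mul_le_iff₀ hn']
    exact h

lemma norm_cdGradient_le (hC : ∀ x j, |φ x j| ≤ C) (hC0 : 0 ≤ Real.sqrt d * C) (y : Fin n → 𝒳) :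
    ‖cdGradient φ x y‖ ≤ 2 * (Real.sqrt d * C) := by
  refine (norm_sub_le _ _).trans ?_
  have h1 := norm_average_le hC0 fun i => norm_le_sqrt_mul _ (hC (x i))
  have h2 := norm_average_le hC0 fun i => norm_le_sqrt_mul _ (hC (y i))
  linarith

/-- A point farther than `‖v‖` from the frontier of `Θ` can be moved by `v` within `Θ`. -/
lemma add_mem_of_norm_lt_infDist {θ v : E d} (hθ : θ ∈ Θ)
    (hv : ‖v‖ < Metric.infDist θ (frontier Θ)) : θ + v ∈ Θ := by
  by_contra hnot
  obtain ⟨y, hy, hdist⟩ := exists_mem_frontier_infDist_compl_eq_dist hθ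
    (Set.ne_univ_iff_exists_notMem Θ |>.2 ⟨_, hnot⟩)
  have h1 : Metric.infDist θ Θᶜ ≤ dist θ (θ + v) :=
    Metric.infDist_le_dist_of_mem (Set.mem_compl hnot)
  rw [dist_self_add_right, hdist] at h1
  exact absurd ((Metric.infDist_le_dist_of_mem hy).trans h1) (not_le.2 hv)

/-- The conditional mean of the CD gradient at the parameter `θ`. -/
noncomputable def cdDrift (φ : 𝒳 → E d) (k : E d → Kernel 𝒳 𝒳) (m : ℕ) (x : Fin n → 𝒳)
    (θ : E d) : E d :=
  (1 / n : ℝ) • ∑ i, φ (x i) - (1 / n : ℝ) • ∑ i, ∫ y, φ y ∂((k θ ^ m) (x i))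

section Run

variable {Ω : Type*} [mΩ : MeasurableSpace Ω] {P : Measure Ω} [IsProbabilityMeasure P]
  {ℱ : Filtration ℕ mΩ} {θ : ℕ → Ω → E d} {Y : ℕ → Fin n → Ω → 𝒳}

lemma norm_step_le (h : IsCDRun P ℱ φ C Θ k m η x θ Y) (hC : ∀ x j, |φ x j| ≤ C)
    (hC0 : 0 ≤ Real.sqrt d * C) (hη : ∀ t, 0 ≤ η t) (t : ℕ) (ω : Ω) :
    ‖θ (t + 1) ω - θ t ω‖ ≤ 2 * (Real.sqrt d * C) * η t := by
  by_cases hb : θ t ω ∈ boundaryLayer Θ C (η t)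
  · rw [h.step_boundary t ω hb, sub_self, norm_zero]
    have := hη t
    positivity
  · rw [h.step_inside t ω hb, add_sub_cancel_left, norm_smul, Real.norm_of_nonneg (hη t), mul_comm]
    exact mul_le_mul_of_nonneg_right (norm_cdGradient_le hC hC0 _) (hη t)

/-- Outside the boundary layer the frontier is farther than the longest possible step; inside it the
iterate does not move. -/
lemma IsCDRun.mem (h : IsCDRun P ℱ φ C Θ k m η x θ Y) (hC : ∀ x j, |φ x j| ≤ C)
    (hC0 : 0 ≤ Real.sqrt d * C) (hη : ∀ t, 0 ≤ η t) (t : ℕ) (ω : Ω) : θ t ω ∈ Θ := by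
  induction t with
  | zero => exact h.init ω
  | succ t ih =>
    by_cases hb : θ t ω ∈ boundaryLayer Θ C (η t)
    · rwa [h.step_boundary t ω hb]
    · have h1 : ¬ Metric.infDist (θ t ω) (frontier Θ) ≤ 2 * η t * Real.sqrt d * C :=
        fun hle => hb ⟨ih, hle⟩
      have h2 := norm_step_le h hC hC0 hη t ω
      have := add_mem_of_norm_lt_infDist (v := θ (t + 1) ω - θ t ω) ih (by linarith [not_le.1 h1])
      rwa [add_sub_cancel] at this

/-- Only a marginal of the product law is needed: test boxes are the whole space in every coordinate
but `i`. -/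
lemma IsCDRun.condExp_comp (h : IsCDRun P ℱ φ C Θ k m η x θ Y)
    (hk : ∀ θ ∈ Θ, IsMarkovKernel (k θ)) (hmem : ∀ t ω, θ t ω ∈ Θ) (t : ℕ) (i : Fin n)
    {f : 𝒳 → ℝ} {B : ℝ} (hf : Measurable f) (hB : ∀ x, |f x| ≤ B) :
    P[fun ω => f (Y t i ω) | ℱ t] =ᵐ[P] fun ω => ∫ y, f y ∂((k (θ t ω) ^ m) (x i)) := by
  have hprob : ∀ ω j, IsProbabilityMeasure ((k (θ t ω) ^ m) (x j)) := fun ω j => by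
    have := hk _ (hmem t ω)
    have := isMarkovKernel_pow (k (θ t ω)) m
    infer_instance
  refine condExp_comp_ae_eq (ℱ.le t) (h.measurable_sample t i) (fun ω => hprob ω i)
    (fun S hS => ?_) hf hB
  classical
  have hA := h.cond_law t (Function.update (fun _ => Set.univ) i S) fun j => by
    by_cases hj : j = i
    · subst hj; simpa using hS
    · simp [hj]
  have e1 : (⋂ j, Y t j ⁻¹' (Function.update (fun _ => Set.univ) i S) j) = Y t i ⁻¹' S := by
    ext ω
    simp only [Set.mem_iInter, Set.mem_preimage]
    refine ⟨fun H => by simpa using H i, fun H j => ?_⟩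
    by_cases hj : j = i
    · subst hj; simpa using H
    · simp [hj]
  have e2 : ∀ ω, ∏ j, ((k (θ t ω) ^ m) (x j)).real
      ((Function.update (fun _ => Set.univ) i S : Fin n → Set 𝒳) j)
      = ((k (θ t ω) ^ m) (x i)).real S := fun ω => by
    rw [Finset.prod_eq_single i]
    · simp
    · intro j _ hj
      have := hprob ω j
      simp [hj]
    · simp
  rw [e1] at hA
  filter_upwards [hA] with ω hω
  rw [hω, e2]

lemma measurableSet_boundaryLayer (hΘ : IsClosed Θ) (C ηt : ℝ) :
    MeasurableSet (boundaryLayer Θ C ηt) :=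
  hΘ.measurableSet.inter
    (measurableSet_le (Metric.continuous_infDist_pt _).measurable measurable_const)

open Classical in
/-- The conditional mean of the increment of the CD iteration in the direction of its error. -/
lemma IsCDRun.condExp_inner_step (h : IsCDRun P ℱ φ C Θ k m η x θ Y) (hφ : Measurable φ)
    (hC : ∀ x j, |φ x j| ≤ C) (hC0 : 0 ≤ Real.sqrt d * C) (hη : ∀ t, 0 ≤ η t)
    (hΘ : IsCompact Θ) (hk : ∀ θ ∈ Θ, IsMarkovKernel (k θ)) {θhat : E d} (hhat : θhat ∈ Θ)
    (t : ℕ) :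
    P[fun ω => inner ℝ (θ t ω - θhat) (θ (t + 1) ω - θ t ω) | ℱ t] =ᵐ[P]
      fun ω => if θ t ω ∈ boundaryLayer Θ C (η t) then 0
        else η t * inner ℝ (θ t ω - θhat) (cdDrift φ k m x (θ t ω)) := by
  have hmem := h.mem hC hC0 hη
  -- The inner product is a sum over coordinates and data points of an `ℱ t`-measurable factor `c`
  -- times a bounded function of one sample, so the factor can be pulled out.
  set c : Fin d → Ω → ℝ := fun j ω => if θ t ω ∈ boundaryLayer Θ C (η t) then 0
    else η t * (1 / n) * (θ t ω - θhat) j with hc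
  set f : Fin d → Fin n → 𝒳 → ℝ := fun j i y => φ (x i) j - φ y j with hf
  have hfm : ∀ j i, Measurable (f j i) := fun j i => by fun_prop
  have hfB : ∀ j i y, |f j i y| ≤ C + C := fun j i y =>
    (abs_sub _ _).trans (add_le_add (hC _ _) (hC _ _))
  have hcm : ∀ j, StronglyMeasurable[ℱ t] (c j) := fun j => by
    refine Measurable.stronglyMeasurable ?_
    refine Measurable.ite (h.adapted t (measurableSet_boundaryLayer hΘ.isClosed C (η t)))
      measurable_const ?_
    have : Measurable fun v : E d => η t * (1 / n) * (v - θhat) j := by fun_prop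
    exact this.comp (h.adapted t)
  have hcB : ∀ j ω, ‖c j ω‖ ≤ η t * (1 / n) * Metric.diam Θ := fun j ω => by
    have hη' := hη t
    by_cases hb : θ t ω ∈ boundaryLayer Θ C (η t)
    · simp only [hc, hb, if_true, norm_zero]
      positivity
    · simp only [hc, hb, if_false]
      rw [norm_mul, Real.norm_of_nonneg (by positivity)]
      refine mul_le_mul_of_nonneg_left ?_ (by positivity)
      refine (PiLp.norm_apply_le _ j).trans ?_
      rw [← dist_eq_norm]
      exact Metric.dist_le_diam_of_mem hΘ.isBounded (hmem t ω) hhat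
  have hfi : ∀ j i, Integrable (fun ω => f j i (Y t i ω)) P := fun j i =>
    Integrable.of_bound ((hfm j i).comp (h.measurable_sample t i)).aestronglyMeasurable (C + C)
      (Eventually.of_forall fun ω => hfB j i _)
  have hcf : ∀ j i, Integrable (c j * fun ω => f j i (Y t i ω)) P := fun j i =>
    (hfi j i).bdd_mul ((hcm j).mono (ℱ.le t)).aestronglyMeasurable
      (Eventually.of_forall (hcB j))
  have hWeq : (fun ω => inner ℝ (θ t ω - θhat) (θ (t + 1) ω - θ t ω))
      = ∑ p : Fin d × Fin n, c p.1 * fun ω => f p.1 p.2 (Y t p.2 ω) := by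
    ext ω
    rw [Finset.sum_apply]
    by_cases hb : θ t ω ∈ boundaryLayer Θ C (η t)
    · simp [h.step_boundary t ω hb, hc, hb]
    · rw [h.step_inside t ω hb, add_sub_cancel_left, Fintype.sum_prod_type]
      simp only [hc, hb, if_false, Pi.mul_apply, PiLp.inner_apply, cdGradient, hf,
        PiLp.smul_apply, PiLp.sub_apply, WithLp.ofLp_sum, Finset.sum_apply, smul_eq_mul,
        RCLike.inner_apply, conj_trivial, ← Finset.mul_sum, Finset.sum_sub_distrib]
      exact Finset.sum_congr rfl fun j _ => by ring
  rw [hWeq]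
  have hterm : ∀ p : Fin d × Fin n, P[c p.1 * fun ω => f p.1 p.2 (Y t p.2 ω) | ℱ t] =ᵐ[P]
      fun ω => c p.1 ω * ∫ y, f p.1 p.2 y ∂((k (θ t ω) ^ m) (x p.2)) := fun p => by
    filter_upwards [condExp_mul_of_stronglyMeasurable_left (hcm p.1) (hcf p.1 p.2) (hfi p.1 p.2),
      h.condExp_comp hk hmem t p.2 (hfm p.1 p.2) (hfB p.1 p.2)] with ω h1 h2
    rw [h1, Pi.mul_apply, h2]
  filter_upwards [condExp_finsetSum (s := Finset.univ)
      (fun (p : Fin d × Fin n) _ => hcf p.1 p.2) (ℱ t), ae_all_iff.2 hterm]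
    with ω h1 h2
  rw [h1, Finset.sum_apply, Finset.sum_congr rfl fun p _ => h2 p]
  by_cases hb : θ t ω ∈ boundaryLayer Θ C (η t)
  · simp [hc, hb]
  · have := hk _ (hmem t ω)
    have := isMarkovKernel_pow (k (θ t ω)) m
    have hφi : ∀ i, Integrable φ ((k (θ t ω) ^ m) (x i)) := fun i =>
      Integrable.of_bound hφ.aestronglyMeasurable _
        (Eventually.of_forall fun y => norm_le_sqrt_mul _ (hC y))
    have e : ∀ j i, ∫ y, f j i y ∂((k (θ t ω) ^ m) (x i))
        = φ (x i) j - (∫ y, φ y ∂((k (θ t ω) ^ m) (x i))) j := fun j i => by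
      have hji : Integrable (fun y => φ y j) ((k (θ t ω) ^ m) (x i)) :=
        integrable_of_abs_le (by fun_prop) fun y => hC y j
      have hj : ∫ y, φ y j ∂((k (θ t ω) ^ m) (x i)) = (∫ y, φ y ∂((k (θ t ω) ^ m) (x i))) j :=
        (EuclideanSpace.proj (𝕜 := ℝ) j).integral_comp_comm (hφi i)
      rw [← hj]
      simp only [hf]
      rw [integral_sub (integrable_const _) hji]
      simp
    simp only [hc, hb, if_false, e]
    rw [Fintype.sum_prod_type]
    simp only [PiLp.inner_apply, cdDrift,
        PiLp.smul_apply, PiLp.sub_apply, WithLp.ofLp_sum, Finset.sum_apply, smul_eq_mul,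
        RCLike.inner_apply, conj_trivial, ← Finset.mul_sum, Finset.sum_sub_distrib]
    rw [Finset.mul_sum]
    exact Finset.sum_congr rfl fun j _ => by ring

end Run

end Algorithm

/-! ### From summed error bounds to weighted averages. -/

section Average

variable {d : ℕ} {η : ℕ → ℝ}

lemma norm_wavg_sub_le (hη : ∀ t, 0 ≤ η t) (θ : ℕ → E d) (θhat : E d) (t : ℕ)
    (hS : 0 < ∑ s ∈ Finset.range (t + 1), η s) :
    ‖wavg η θ t - θhat‖ ≤ (∑ s ∈ Finset.range (t + 1), η s)⁻¹
      * ∑ s ∈ Finset.range (t + 1), η s * ‖θ s - θhat‖ := by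
  have e : wavg η θ t - θhat = (∑ s ∈ Finset.range (t + 1), η s)⁻¹
      • ∑ s ∈ Finset.range (t + 1), η s • (θ s - θhat) := by
    simp only [smul_sub, Finset.sum_sub_distrib, ← Finset.sum_smul]
    rw [wavg, inv_smul_smul₀ hS.ne']
  rw [e, norm_smul, Real.norm_of_nonneg (inv_pos.2 hS).le]
  refine mul_le_mul_of_nonneg_left ?_ (inv_pos.2 hS).le
  refine norm_sum_le_of_le _ fun s _ => ?_
  rw [norm_smul, Real.norm_of_nonneg (hη s)]

/-- The constant `K₁` disappears on division by the diverging sum of learning rates. -/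
lemma limsup_enorm_wavg_le (hη : ∀ t, 0 ≤ η t)
    (hS : Tendsto (fun t => ∑ s ∈ Finset.range (t + 1), η s) atTop atTop)
    (θ : ℕ → E d) (θhat : E d) {b K₁ : ℝ}
    (h : ∀ t, ∑ s ∈ Finset.range (t + 1), η s * (‖θ s - θhat‖ - b) ≤ K₁) :
    limsup (fun t => ‖wavg η θ t - θhat‖ₑ) atTop ≤ ENNReal.ofReal b := by
  have hlim : Tendsto (fun t => ENNReal.ofReal
      (b + K₁ / ∑ s ∈ Finset.range (t + 1), η s)) atTop (𝓝 (ENNReal.ofReal b)) := by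
    refine ENNReal.tendsto_ofReal ?_
    simpa using (tendsto_const_nhds (x := b)).add (hS.const_div_atTop K₁)
  rw [← hlim.limsup_eq]
  refine limsup_le_limsup ?_
  filter_upwards [hS.eventually_gt_atTop 0] with t ht
  rw [← ofReal_norm]
  refine ENNReal.ofReal_le_ofReal ((norm_wavg_sub_le hη θ θhat t ht).trans ?_)
  have h' := h t
  simp only [mul_sub, Finset.sum_sub_distrib, ← Finset.sum_mul] at h'
  rw [inv_mul_le_iff₀ ht, mul_add, mul_div_cancel₀ _ ht.ne']
  linarith

/-- Square-integrated control of the error, off a finite set of times, bounds the averages. -/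
lemma limsup_enorm_wavg_le_of_quadratic (hη : ∀ t, 0 ≤ η t)
    (hS : Tendsto (fun t => ∑ s ∈ Finset.range (t + 1), η s) atTop atTop)
    (θ : ℕ → E d) (θhat : E d) {a c K₀ : ℝ} (ha : 0 < a) (hc : 0 < c) {J : Set ℕ}
    (hJ : J.Finite) {w : ℕ → ℝ} (hw0 : ∀ s ∈ J, w s = 0)
    (hw : ∀ s ∉ J, η s * (a * ‖θ s - θhat‖ ^ 2 - c * ‖θ s - θhat‖) ≤ w s)
    (h : ∀ t, ∑ s ∈ Finset.range (t + 1), w s ≤ K₀) :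
    limsup (fun t => ‖wavg η θ t - θhat‖ₑ) atTop ≤ ENNReal.ofReal (c / a) := by
  classical
  -- `g` pays for the finitely many times in `J`, where no quadratic bound is available; its total
  -- is a finite constant.
  set g : ℕ → ℝ := fun s => if s ∈ J then |η s * (‖θ s - θhat‖ - c / a)| else 0 with hg
  have hg0 : ∀ s, 0 ≤ g s := fun s => by
    simp only [hg]
    split_ifs
    exacts [abs_nonneg _, le_rfl]
  refine limsup_enorm_wavg_le hη hS θ θhat (K₁ := K₀ / c + ∑ s ∈ hJ.toFinset, g s) fun t => ?_
  have hterm : ∀ s, η s * (‖θ s - θhat‖ - c / a) ≤ w s / c + g s := fun s => by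
    by_cases hs : s ∈ J
    · simp only [hg, hs, if_true, hw0 s hs, zero_div, zero_add]
      exact le_abs_self _
    · simp only [hg, hs, if_false, add_zero]
      rw [le_div_iff₀ hc]
      refine le_trans ?_ (hw s hs)
      rw [mul_assoc]
      refine mul_le_mul_of_nonneg_left ?_ (hη s)
      -- Completing the square: `c (v - c / a) ≤ a v² - c v` for every `v`, which linearises the
      -- quadratic bound.
      have h1 : 0 ≤ a * (‖θ s - θhat‖ - c / a) ^ 2 := by positivity
      have h2 : a * (‖θ s - θhat‖ - c / a) ^ 2 = a * ‖θ s - θhat‖ ^ 2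
          - 2 * (a * (c / a)) * ‖θ s - θhat‖ + a * (c / a) * (c / a) := by ring
      rw [mul_div_cancel₀ c ha.ne'] at h2
      linarith
  refine (Finset.sum_le_sum fun s _ => hterm s).trans ?_
  rw [Finset.sum_add_distrib, ← Finset.sum_div]
  refine add_le_add (div_le_div_of_nonneg_right (h t) hc.le) ?_
  have h3 : ∑ s ∈ Finset.range (t + 1), g s
      = ∑ s ∈ (Finset.range (t + 1)).filter (· ∈ J), g s := by
    rw [Finset.sum_filter]
    refine Finset.sum_congr rfl fun s _ => ?_
    simp only [hg]
    split_ifs <;> rfl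
  rw [h3]
  refine Finset.sum_le_sum_of_subset_of_nonneg (fun s hs => ?_) fun s _ _ => hg0 s
  simpa using (Finset.mem_filter.1 hs).2

lemma tendsto_sum_of_div_sqrt_log
    (h : Tendsto (fun t : ℕ => (∑ s ∈ Finset.range (t + 1), η s) / Real.sqrt (Real.log t))
      atTop atTop) : Tendsto (fun t => ∑ s ∈ Finset.range (t + 1), η s) atTop atTop := by
  have hlog : Tendsto (fun t : ℕ => Real.sqrt (Real.log t)) atTop atTop :=
    Real.tendsto_sqrt_atTop.comp (Real.tendsto_log_atTop.comp tendsto_natCast_atTop_atTop)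
  refine (h.atTop_mul_atTop₀ hlog).congr' ?_
  filter_upwards [hlog.eventually_gt_atTop 0] with t ht
  exact div_mul_cancel₀ _ ht.ne'

end Average

/-! ### The drift inequality. -/

section Drift

variable {𝒳 : Type*} [MeasurableSpace 𝒳] {ν : Measure 𝒳} [IsFiniteMeasure ν] {d : ℕ}
  {φ : 𝒳 → E d} {C : ℝ} {Θ : Set (E d)} {θstar θhat : E d} {L : ℝ≥0} {k : E d → Kernel 𝒳 𝒳}
  {m n : ℕ} {x : Fin n → 𝒳}

lemma integrable_stat (hφ : Measurable φ) (hC : ∀ x j, |φ x j| ≤ C) (μ : Measure 𝒳)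
    [IsFiniteMeasure μ] : Integrable φ μ :=
  Integrable.of_bound hφ.aestronglyMeasurable _
    (Eventually.of_forall fun y => norm_le_sqrt_mul _ (hC y))

lemma norm_integral_stat_le (hC : ∀ x j, |φ x j| ≤ C) (μ : Measure 𝒳) [IsProbabilityMeasure μ] :
    ‖∫ y, φ y ∂μ‖ ≤ Real.sqrt d * C := by
  simpa using norm_integral_le_of_norm_le_const (μ := μ)
    (Eventually.of_forall fun y => norm_le_sqrt_mul _ (hC y))

/-- A real supremum dominates its terms only if the family is bounded above, which the bound on `φ`
supplies. -/
lemma sqrt_mul_norm_le_empiricalDeviation (hν : ν ≠ 0) (hφ : Measurable φ)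
    (hC : ∀ x j, |φ x j| ≤ C) (hC0 : 0 ≤ Real.sqrt d * C)
    (hk : ∀ θ ∈ Θ, IsMarkovKernel (k θ)) {θ : E d} (hθ : θ ∈ Θ) :
    Real.sqrt n * ‖(1 / n : ℝ) • ∑ i, (∫ y, φ y ∂((k θ ^ m) (x i)))
      - ∫ y, φ y ∂((law ν φ θstar).bind (k θ ^ m))‖
      ≤ empiricalDeviation ν φ Θ θstar k m x := by
  refine le_ciSup (f := fun θ : Θ => Real.sqrt n *
    ‖(1 / n : ℝ) • ∑ i, (∫ y, φ y ∂((k θ ^ m) (x i)))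
      - ∫ y, φ y ∂((law ν φ θstar).bind (k θ ^ m))‖)
    ⟨Real.sqrt n * (Real.sqrt d * C + Real.sqrt d * C), ?_⟩ ⟨θ, hθ⟩
  rintro _ ⟨⟨θ', hθ'⟩, rfl⟩
  have := hk θ' hθ'
  have := isMarkovKernel_pow (k θ') m
  have := isProbabilityMeasure_law hν hφ hC θstar
  refine mul_le_mul_of_nonneg_left ((norm_sub_le _ _).trans (add_le_add ?_ ?_))
    (Real.sqrt_nonneg _)
  · exact norm_average_le hC0 fun i => norm_integral_stat_le hC _
  · exact norm_integral_stat_le hC _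

/-- The drift of CD points towards an interior maximum likelihood estimate. -/
lemma inner_cdDrift_le (hν : ν ≠ 0) (hφ : Measurable φ) (hC : ∀ x j, |φ x j| ≤ C)
    (hC0 : 0 ≤ Real.sqrt d * C) (hΘconv : Convex ℝ Θ) (hθstar : θstar ∈ Θ)
    (hL : LipschitzOnWith L (chi ν φ θstar) Θ) (hk : ∀ θ ∈ Θ, IsMarkovKernel (k θ))
    (hinv : ∀ θ ∈ Θ, Kernel.Invariant (k θ) (law ν φ θ)) (hgap : alpha ν φ Θ k < 1)
    (hn : 1 ≤ n) (hMLE : IsMLE ν φ Θ x θhat) (hint : θhat ∈ interior Θ) {ε : ℝ}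
    (hε : ‖θhat - θstar‖ ≤ ε)
    (hdev : empiricalDeviation ν φ Θ θstar k m x ≤ Real.sqrt n * ε) {θ : E d} (hθ : θ ∈ Θ) :
    inner ℝ (θ - θhat) (cdDrift φ k m x θ) ≤ -(aCoef ν φ Θ k C L m) * ‖θ - θhat‖ ^ 2
      + (1 + Real.sqrt d * C * L * (alpha ν φ Θ k).toReal ^ m) * ε * ‖θ - θhat‖ := by
  have := hk θ hθ
  have := isMarkovKernel_pow (k θ) m
  have := isProbabilityMeasure_law hν hφ hC θstar
  set u := θ - θhat with hu
  set α := (alpha ν φ Θ k).toReal with hα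
  have hα0 : 0 ≤ α := ENNReal.toReal_nonneg
  set emp : E d := (1 / n : ℝ) • ∑ i, ∫ y, φ y ∂((k θ ^ m) (x i)) with hemp
  set pop : E d := ∫ y, φ y ∂((law ν φ θstar).bind (k θ ^ m)) with hpop
  have h1 : inner ℝ u (cdDrift φ k m x θ)
      = ∫ y, inner ℝ u (φ y) ∂(law ν φ θhat) - inner ℝ u emp := by
    rw [← hMLE.moment_eq hν hφ hC hn hint u, cdDrift, inner_sub_right, inner_smul_right, inner_sum]
  have h2 : -inner ℝ u emp ≤ -inner ℝ u pop + ‖u‖ * ε := by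
    have hnorm : ‖emp - pop‖ ≤ ε := by
      have := (sqrt_mul_norm_le_empiricalDeviation (θstar := θstar) (m := m) (x := x)
        hν hφ hC hC0 hk hθ).trans hdev
      exact le_of_mul_le_mul_left this (Real.sqrt_pos.2 (by exact_mod_cast hn))
    have := (abs_le.1 ((abs_real_inner_le_norm u (emp - pop)).trans
      (mul_le_mul_of_nonneg_left hnorm (norm_nonneg u)))).1
    rw [inner_sub_right] at this
    linarith
  have h3 : -inner ℝ u pop ≤ -∫ y, inner ℝ u (φ y) ∂(law ν φ θ)
      + α ^ m * (‖u‖ * (Real.sqrt d * C)) * chi ν φ θstar θ := by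
    have e : inner ℝ u pop = ∫ y, inner ℝ u (φ y) ∂((law ν φ θstar).bind (k θ ^ m)) :=
      (integral_inner (integrable_stat hφ hC _) u).symm
    have := (abs_le.1 (abs_integral_law_sub_le hν hφ hC θstar θ (k θ) (hinv θ hθ) hα0
      (l2Norm_le_alpha hgap hθ) m (measurable_inner_stat hφ u)
      (mul_nonneg (norm_nonneg u) hC0) (abs_inner_le hC u))).2
    rw [e]
    linarith
  have h4 := lam_mul_le_integral_sub hν hφ hC hΘconv hMLE.1 hθ
  -- The `‖u‖` part of the bias lowers `λ` to `aCoef`; the `ε` part joins the linear error term.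
  have h5 : chi ν φ θstar θ ≤ L * (‖u‖ + ε) := by
    refine (chi_le hL hθstar hθ).trans (mul_le_mul_of_nonneg_left ?_ L.2)
    have := norm_add_le u (θhat - θstar)
    rw [hu, sub_add_sub_cancel] at this
    linarith
  have h6 : α ^ m * (‖u‖ * (Real.sqrt d * C)) * chi ν φ θstar θ
      ≤ α ^ m * (‖u‖ * (Real.sqrt d * C)) * (L * (‖u‖ + ε)) :=
    mul_le_mul_of_nonneg_left h5
      (mul_nonneg (pow_nonneg hα0 m) (mul_nonneg (norm_nonneg u) hC0))
  rw [h1, aCoef]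
  nlinarith

end Drift

end CD

/-! ### The main theorem. -/

open CD in
theorem mainTheorem2
    {𝒳 : Type*} [MeasurableSpace 𝒳] (ν : Measure 𝒳) [IsFiniteMeasure ν] (hν : ν ≠ 0)
    {d : ℕ} (φ : 𝒳 → CD.E d) (hφ : Measurable φ)
    (C : ℝ) (hC : ∀ x j, |φ x j| ≤ C)
    (Θ : Set (CD.E d)) (hΘ : IsCompact Θ) (hΘconv : Convex ℝ Θ)
    (θstar : CD.E d) (hθstar : θstar ∈ interior Θ)
    (hindep : ∀ θ ∈ Θ, CD.LinIndepUnder ν φ θ)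
    (L : ℝ≥0) (hL : LipschitzOnWith L (CD.chi ν φ θstar) Θ)
    (k : CD.E d → Kernel 𝒳 𝒳) (hk : ∀ θ ∈ Θ, IsMarkovKernel (k θ))
    (hinv : ∀ θ ∈ Θ, Kernel.Invariant (k θ) (CD.law ν φ θ))
    (hgap : CD.alpha ν φ Θ k < 1)
    (m : ℕ) (ham : 0 < CD.aCoef ν φ Θ k C L m) :
    ∃ K : ℝ, ∀ γ : ℝ, 0 < γ → γ < 1 / 2 →
      ∀ η : ℕ → ℝ, (∀ t, 0 ≤ η t) →
      Tendsto (fun t : ℕ => (∑ s ∈ Finset.range (t + 1), η s) / Real.sqrt (Real.log t))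
        atTop atTop →
      Summable (fun t => η t ^ 2) →
      ∀ n : ℕ, 1 ≤ n → ∀ x : Fin n → 𝒳, ∀ θhat : CD.E d, CD.IsMLE ν φ Θ x θhat →
      Real.sqrt n * ‖θhat - θstar‖ < (n : ℝ) ^ γ →
      CD.empiricalDeviation ν φ Θ θstar k m x < (n : ℝ) ^ γ →
      ∀ (Ω : Type*) [mΩ : MeasurableSpace Ω] (P : Measure Ω) [IsProbabilityMeasure P]
        (ℱ : Filtration ℕ mΩ) (θ : ℕ → Ω → CD.E d) (Y : ℕ → Fin n → Ω → 𝒳),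
      CD.IsCDRun P ℱ φ C Θ k m η x θ Y →
      ∀ᵐ ω ∂P, {t | θ t ω ∈ CD.boundaryLayer Θ C (η t)}.Finite →
        limsup (fun t => ‖CD.wavg η (fun s => θ s ω) t - θhat‖ₑ) atTop
          ≤ ENNReal.ofReal (K * (n : ℝ) ^ (-(1 - 2 * γ) / 3)) := by
  classical
  have h𝒳 : Nonempty 𝒳 := by
    by_contra hne
    rw [not_nonempty_iff] at hne
    exact hν ν.eq_zero_of_isEmpty
  obtain ⟨x₀⟩ := h𝒳
  have hC0 : 0 ≤ Real.sqrt d * C := (norm_nonneg _).trans (norm_le_sqrt_mul _ (hC x₀))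
  obtain ⟨ρ, hρ, hball⟩ := Metric.isOpen_iff.1 isOpen_interior θstar hθstar
  set a := aCoef ν φ Θ k C L m with ha
  set b := 1 + Real.sqrt d * C * L * (alpha ν φ Θ k).toReal ^ m with hb
  have hb0 : 0 < b := by
    have : 0 ≤ Real.sqrt d * C * L * (alpha ν φ Θ k).toReal ^ m :=
      mul_nonneg (mul_nonneg hC0 L.2) (pow_nonneg ENNReal.toReal_nonneg m)
    linarith
  set D := Metric.diam Θ with hD
  have hD0 : 0 ≤ D := Metric.diam_nonneg
  -- `b / a` serves the case of an interior `θhat`, `D / ρ` the trivial bound when `ε ≥ ρ`.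
  refine ⟨b / a + D / ρ, fun γ hγ0 hγ η hη hηlog hη2 n hn x θhat hMLE hhat hdev Ω mΩ P _ ℱ θ Y
    hrun => ?_⟩
  have hn0 : (0 : ℝ) < n := by exact_mod_cast hn
  have hsn : 0 < Real.sqrt n := Real.sqrt_pos.2 hn0
  set ε := (n : ℝ) ^ γ / Real.sqrt n with hε
  have hε0 : 0 < ε := div_pos (Real.rpow_pos_of_pos hn0 γ) hsn
  -- `ε = n ^ (-(1 - 2γ) / 2)`, which is even smaller than the required rate since `n ≥ 1` and `γ <
  -- 1 / 2`.
  have hεle : ε ≤ (n : ℝ) ^ (-(1 - 2 * γ) / 3) := by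
    rw [hε, Real.sqrt_eq_rpow, ← Real.rpow_sub hn0]
    exact Real.rpow_le_rpow_of_exponent_le (by exact_mod_cast hn) (by linarith)
  have hhat' : ‖θhat - θstar‖ ≤ ε := by
    rw [hε, le_div_iff₀ hsn, mul_comm]
    exact hhat.le
  have hdev' : empiricalDeviation ν φ Θ θstar k m x ≤ Real.sqrt n * ε := by
    rw [hε, mul_div_cancel₀ _ hsn.ne']
    exact hdev.le
  have hS := tendsto_sum_of_div_sqrt_log hηlog
  have hmem := hrun.mem hC hC0 hη
  have hdist : ∀ t ω, ‖θ t ω - θhat‖ ≤ D := fun t ω => by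
    rw [← dist_eq_norm]
    exact Metric.dist_le_diam_of_mem hΘ.isBounded (hmem t ω) hMLE.1
  -- For `ε ≥ ρ` the estimate may lie on the frontier and the likelihood equation may fail, but `D ≤
  -- (D / ρ) ε` suffices.
  rcases le_or_gt ρ ε with hρε | hερ
  · refine Eventually.of_forall fun ω _ => ?_
    refine (limsup_enorm_wavg_le hη hS _ θhat (b := D) (K₁ := 0) fun t => ?_).trans ?_
    · exact Finset.sum_nonpos fun s _ =>
        mul_nonpos_of_nonneg_of_nonpos (hη s) (sub_nonpos.2 (hdist s ω))
    · refine ENNReal.ofReal_le_ofReal ?_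
      have h1 : D / ρ * ρ ≤ (b / a + D / ρ) * (n : ℝ) ^ (-(1 - 2 * γ) / 3) := by
        refine mul_le_mul ?_ (hρε.trans hεle) hρ.le (by positivity)
        linarith [div_pos hb0 ham]
      rwa [div_mul_cancel₀ _ hρ.ne'] at h1
  have hint : θhat ∈ interior Θ := hball (by
    rw [Metric.mem_ball, dist_eq_norm]
    exact hhat'.trans_lt hερ)
  set W : ℕ → Ω → ℝ := fun t ω => inner ℝ (θ t ω - θhat) (θ (t + 1) ω - θ t ω) with hW
  have hWm : ∀ t, StronglyMeasurable[ℱ (t + 1)] (W t) := fun t => by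
    have h1 : Measurable[ℱ (t + 1)] (θ t) := (hrun.adapted t).mono (ℱ.mono (Nat.le_succ t)) le_rfl
    have h2 : Measurable[ℱ (t + 1)] (θ (t + 1)) := hrun.adapted (t + 1)
    exact ((h1.sub_const θhat).inner (h2.sub h1)).stronglyMeasurable
  have hWc : ∀ t ω, |W t ω| ≤ D * (2 * (Real.sqrt d * C) * η t) := fun t ω =>
    (abs_real_inner_le_norm _ _).trans
      (mul_le_mul (hdist t ω) (norm_step_le hrun hC hC0 hη t ω) (norm_nonneg _) hD0)
  have hc2 : Summable fun t => (D * (2 * (Real.sqrt d * C) * η t)) ^ 2 := by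
    simp only [← mul_assoc, mul_pow _ (η _)]
    exact hη2.mul_left _
  filter_upwards [ae_exists_tendsto_sum_sub_condExp (P := P) hWm hWc hc2,
    ae_all_iff.2 fun t => hrun.condExp_inner_step hφ hC hC0 hη hΘ hk hMLE.1 t]
    with ω ⟨l, hl⟩ hcond hfin
  -- `M` depends on the path; this is harmless because additive constants do not affect the limsup.
  obtain ⟨M, hM⟩ := hl.bddAbove_range
  refine (limsup_enorm_wavg_le_of_quadratic hη hS (fun s => θ s ω) θhat ham
    (mul_pos hb0 hε0) hfin (w := fun s => -(P[W s | ℱ s]) ω)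
    (K₀ := D ^ 2 / 2 + M + ∑' s, (2 * (Real.sqrt d * C)) ^ 2 * η s ^ 2)
    (fun s hs => ?_) (fun s hs => ?_) fun t => ?_).trans ?_
  · simp only [hW, hcond s, if_pos (show θ s ω ∈ boundaryLayer Θ C (η s) from hs), neg_zero]
  · simp only [hW, hcond s, if_neg (show θ s ω ∉ boundaryLayer Θ C (η s) from hs)]
    rw [← mul_neg]
    refine mul_le_mul_of_nonneg_left ?_ (hη s)
    have := inner_cdDrift_le hν hφ hC hC0 hΘconv (interior_subset hθstar) hL hk hinv hgap hn hMLE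
      hint hhat' hdev' (hmem s ω)
    linarith
  · have htel : ∀ T, ‖θ T ω - θhat‖ ^ 2 = ‖θ 0 ω - θhat‖ ^ 2
        + ∑ s ∈ Finset.range T, (2 * W s ω + ‖θ (s + 1) ω - θ s ω‖ ^ 2) := fun T => by
      induction T with
      | zero => simp
      | succ T ih =>
        have := norm_add_sq_real (θ T ω - θhat) (θ (T + 1) ω - θ T ω)
        rw [show θ T ω - θhat + (θ (T + 1) ω - θ T ω) = θ (T + 1) ω - θhat by abel] at this
        rw [this, ih, Finset.sum_range_succ]
        simp only [hW]
        ring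
    have hT := htel (t + 1)
    rw [Finset.sum_add_distrib, ← Finset.mul_sum] at hT
    have hMt : ∑ s ∈ Finset.range (t + 1), (W s ω - (P[W s | ℱ s]) ω) ≤ M := hM ⟨t + 1, rfl⟩
    rw [Finset.sum_sub_distrib] at hMt
    have h0 : ‖θ 0 ω - θhat‖ ^ 2 ≤ D ^ 2 := pow_le_pow_left₀ (norm_nonneg _) (hdist 0 ω) 2
    have hq : ∑ s ∈ Finset.range (t + 1), ‖θ (s + 1) ω - θ s ω‖ ^ 2
        ≤ ∑' s, (2 * (Real.sqrt d * C)) ^ 2 * η s ^ 2 := by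
      refine (Finset.sum_le_sum fun s _ => ?_).trans
        ((hη2.mul_left _).sum_le_tsum _ fun s _ => by positivity)
      rw [← mul_pow]
      exact pow_le_pow_left₀ (norm_nonneg _) (norm_step_le hrun hC hC0 hη s ω) 2
    have hq0 : 0 ≤ ∑ s ∈ Finset.range (t + 1), ‖θ (s + 1) ω - θ s ω‖ ^ 2 :=
      Finset.sum_nonneg fun s _ => sq_nonneg _
    rw [Finset.sum_neg_distrib]
    linarith [sq_nonneg ‖θ (t + 1) ω - θhat‖]
  · refine ENNReal.ofReal_le_ofReal ?_
    rw [mul_div_right_comm]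
    refine mul_le_mul ?_ hεle hε0.le (by positivity)
    linarith [div_nonneg hD0 hρ.le]
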